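/- Let $n,m,\ell$ be non-negative integers and let $\theta\in\mathbb R$ with $\sin\theta\neq 0$. For $s\in\mathbb R^n$ define on $L^2(\mathbb R^n)=L^2(\mathbb R^n;\mathbb C)$ the $\theta$-translation and the chirp modulation $$T_s^\theta f(t)=e^{-2\pi i\, s\cdot(t-s)\cot\theta}f(t-s),\qquad \mathcal C_\theta f(t)=e^{\pi i |t|^2\cot\theta}f(t).$$ For $\phi_1,\dots,\phi_r\in L^2(\mathbb R^n)$, the $\theta$-shift invariant space generated by $\phi_1,\dots,\phi_r$ is the closed linear span of $\{T_k^\theta\phi_i : 1\le i\le r,\ k\in\mathbb Z^n\}$ in $L^2(\mathbb R^n)$. For a closed subspace $W$ let $P_W$ be the orthogonal projection onto $W$. A countable family $(u_j)$ in $W$ is a Parseval frame for $W$ if $\sum_j|\langle f,u_j\rangle|^2=\|f\|^2$ for all $f\in W$. Let $\hat g(\xi)=\int g(t)e^{-2\pi i t\cdot\xi}\,dt$ denote the Fourier transform, extended to a unitary operator on $L^2(\mathbb R^n)$, put $I=[0,|\sin\theta|]^n$, and for $f\in L^2(\mathbb R^n)$ let $$\tau^\theta(f)(\omega)=\Big(|\sin\theta|^{-n/2}\,\widehat{\mathcal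 C_\theta f}\Big(\frac{\omega}{\sin\theta}+k\Big)\Big)_{k\in\mathbb Z^n},\qquad \omega\in I,$$ be its fiber map. Let $\mathcal F=\{f_1,\dots,f_m\}\subset L^2(\mathbb R^n)$, and let $G^\theta_{\mathcal F}(\omega)$ be the $m\times m$ matrix with entries $$[G^\theta_{\mathcal F}(\omega)]_{ij}=\sum_{k\in\mathbb Z^n}\tau^\theta(f_i)(\omega)_k\,\overline{\tau^\theta(f_j)(\omega)_k}.$$ For almost every $\omega\in I$ these series converge absolutely and the matrix is positive semidefinite; let $\lambda_1(\omega)\ge\dots\ge\lambda_m(\omega)\ge 0$ be its eigenvalues with multiplicity. Each $\lambda_i$ is integrable on $I$, and there exist $\phi_1,\dots,\phi_\ell\in L^2(\mathbb R^n)$ such that, with $V_\theta$ the $\theta$-shift invariant space generated by $\phi_1,\dots,\phi_\ell$, all of the following hold. 1. For every $\theta$-shift invariant space $W_\theta$ generated by at most $\ell$ elements of $L^2(\mathbb R^n)$, $$\sum_{i=1}^m\|f_i-P_{V_\theta}f_i\|^2\le\sum_{i=1}^m\|f_i-P_{W_\theta}f_i\|^2 .$$ 2. The system $\{T_k^\theta\phi_i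 : 1\le i\le\ell,\ k\in\mathbb Z^n\}$ is a Parseval frame for $V_\theta$. 3. $$\sum_{i=1}^m\|f_i-P_{V_\theta}f_i\|^2=\sum_{i=\ell+1}^m\int_I\lambda_i(\omega)\,d\omega ,$$ where the right-hand side is $0$ if $\ell\ge m$. -/

import Mathlib

open MeasureTheory FourierTransform

noncomputable section

/-- The Euclidean space `ℝⁿ`. -/
abbrev RSpace (n : ℕ) : Type := EuclideanSpace ℝ (Fin n)

/-- The Hilbert space `L²(ℝⁿ)` of complex-valued functions, for Lebesgue measure. -/
abbrev L2Space (n : ℕ) : Type := Lp (α := RSpace n) ℂ 2 volume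

/-- An integer vector `k ∈ ℤⁿ`, regarded as a point of `ℝⁿ`. -/
def latticePoint {n : ℕ} (k : Fin n → ℤ) : RSpace n :=
  WithLp.toLp 2 (fun i => (k i : ℝ))

/-- The function `t ↦ exp(-2πi ⟨s, t - s⟩ cot θ) f(t - s)`. -/
def thetaTranslateFun {n : ℕ} (θ : ℝ) (s : RSpace n) (f : RSpace n → ℂ) : RSpace n → ℂ :=
  fun t => Complex.exp (((-2 * Real.pi * inner ℝ s (t - s) * Real.cot θ : ℝ) : ℂ) * Complex.I) *
    f (t - s)

/-- The function `t ↦ exp(πi |t|² cot θ) f(t)`. -/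
def chirpFun {n : ℕ} (θ : ℝ) (f : RSpace n → ℂ) : RSpace n → ℂ :=
  fun t => Complex.exp (((Real.pi * ‖t‖ ^ 2 * Real.cot θ : ℝ) : ℂ) * Complex.I) * f t

theorem memLp_phase_mul {n : ℕ} {p : RSpace n → ℝ} (hp : Continuous p) {f : RSpace n → ℂ}
    (hf : MemLp f 2 volume) :
    MemLp (fun t => Complex.exp ((p t : ℂ) * Complex.I) * f t) 2 volume := by
  have hc : Continuous fun t => Complex.exp ((p t : ℂ) * Complex.I) := by fun_prop
  refine hf.of_le (hc.aestronglyMeasurable.mul hf.1) (Filter.Eventually.of_forall fun t => ?_)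
  rw [norm_mul, Complex.norm_exp_ofReal_mul_I, one_mul]

theorem memLp_thetaTranslateFun {n : ℕ} (θ : ℝ) (s : RSpace n) (f : L2Space n) :
    MemLp (thetaTranslateFun θ s f) 2 volume := by
  have h : MemLp (fun t => f (t - s)) 2 volume :=
    (Lp.memLp f).comp_measurePreserving (measurePreserving_sub_right volume s)
  exact memLp_phase_mul (p := fun t => -2 * Real.pi * inner ℝ s (t - s) * Real.cot θ)
    (by fun_prop) h

theorem memLp_chirpFun {n : ℕ} (θ : ℝ) (f : L2Space n) :
    MemLp (chirpFun θ f) 2 volume :=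
  memLp_phase_mul (p := fun t => Real.pi * ‖t‖ ^ 2 * Real.cot θ) (by fun_prop) (Lp.memLp f)

/-- The `θ`-translation `T_s^θ` on `L²(ℝⁿ)`. -/
def thetaTranslate {n : ℕ} (θ : ℝ) (s : RSpace n) (f : L2Space n) : L2Space n :=
  (memLp_thetaTranslateFun θ s f).toLp

/-- The chirp modulation `C_θ` on `L²(ℝⁿ)`. -/
def chirp {n : ℕ} (θ : ℝ) (f : L2Space n) : L2Space n :=
  (memLp_chirpFun θ f).toLp

/-- The system `{T_k^θ φ_i : i, k ∈ ℤⁿ}` of `θ`-shifts of a finite family `φ_1, …, φ_r`. -/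
def thetaShifts {n r : ℕ} (θ : ℝ) (φ : Fin r → L2Space n) : Fin r × (Fin n → ℤ) → L2Space n :=
  fun p => thetaTranslate θ (latticePoint p.2) (φ p.1)

/-- The `θ`-shift invariant space generated by `φ_1, …, φ_r`: the closed linear span in `L²(ℝⁿ)`
of `{T_k^θ φ_i}`. -/
abbrev thetaShiftSpace {n r : ℕ} (θ : ℝ) (φ : Fin r → L2Space n) : Submodule ℂ (L2Space n) :=
  (Submodule.span ℂ (Set.range (thetaShifts θ φ))).topologicalClosure

/-- `u` is a Parseval frame for the subspace `V`: its members lie in `V`, and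
`∑ |⟨f, u_i⟩|² = ‖f‖²` for all `f ∈ V`. -/
def IsParsevalFrameFor {H ι : Type*} [NormedAddCommGroup H] [InnerProductSpace ℂ H]
    (u : ι → H) (V : Submodule ℂ H) : Prop :=
  (∀ i, u i ∈ V) ∧ ∀ f ∈ V, HasSum (fun i => ‖inner ℂ (u i) f‖ ^ 2) (‖f‖ ^ 2)

/-- The total squared error `∑ ‖f_i - P_V f_i‖²`, where `V` is the `θ`-shift invariant space
generated by `φ` and `P_V` the orthogonal projection onto it. -/
def approxError {n m r : ℕ} (θ : ℝ) (f : Fin m → L2Space n) (φ : Fin r → L2Space n) : ℝ :=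
  ∑ i, ‖f i - (thetaShiftSpace θ φ).starProjection (f i)‖ ^ 2

/-- The cube `I = [0, |sin θ|]ⁿ`. -/
def thetaCube (n : ℕ) (θ : ℝ) : Set (RSpace n) :=
  {ω | ∀ i, ω i ∈ Set.Icc 0 |Real.sin θ|}

/-- The fiber map `τ^θ`: the sequence `k ↦ |sin θ|^{-n/2} (C_θ f)^(ω csc θ + k)`, where `^` is the
unitary Fourier transform on `L²(ℝⁿ)` (with kernel `exp(-2πi ⟨t, ξ⟩)`). The factor makes `τ^θ` an
isometry from `L²(ℝⁿ)` to `L²(I, ℓ²(ℤⁿ))`. As for any element of `L²`, the values are meant for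
almost every `ω`. -/
def thetaFiber {n : ℕ} (θ : ℝ) (f : L2Space n) (ω : RSpace n) (k : Fin n → ℤ) : ℂ :=
  (((Real.sqrt (|Real.sin θ| ^ n))⁻¹ : ℝ) : ℂ) *
    (𝓕 (chirp θ f) : L2Space n) ((Real.sin θ)⁻¹ • ω + latticePoint k)

/-- The fiber Gramian `[G(ω)]_{ij} = ∑_k τ^θ(f_i)(ω)(k) conj (τ^θ(f_j)(ω)(k))`. -/
def thetaGramian {n m : ℕ} (θ : ℝ) (f : Fin m → L2Space n) (ω : RSpace n) :
    Matrix (Fin m) (Fin m) ℂ :=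
  Matrix.of fun i j => ∑' k : Fin n → ℤ, thetaFiber θ (f i) ω k * star (thetaFiber θ (f j) ω k)

theorem isHermitian_thetaGramian {n m : ℕ} (θ : ℝ) (f : Fin m → L2Space n) (ω : RSpace n) :
    (thetaGramian θ f ω).IsHermitian := by
  ext i j
  simp only [thetaGramian, Matrix.conjTranspose_apply, Matrix.of_apply, tsum_star, star_mul,
    star_star]

/-- The eigenvalues of the Hermitian matrix `G(ω)`, with multiplicity and in decreasing order
(indexed from `0`). -/
def thetaGramianEigenvalue {n m : ℕ} (θ : ℝ) (f : Fin m → L2Space n) (i : Fin m)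
    (ω : RSpace n) : ℝ :=
  (isHermitian_thetaGramian θ f ω).eigenvalues₀ (Fin.cast (Fintype.card_fin m).symm i)

end

/-!
Put `Jf = (C_θ f)^`, a unitary operator on `L²(ℝⁿ)`. Completing the square shows that `C_θ` turns
the `θ`-translation `T_k^θ` into ordinary translation by `k`, up to a unimodular constant, so
that `J` turns it into multiplication by the character `ξ ↦ exp(-2πi ⟨k, ξ⟩)`
(`ae_fiber_chirpFourier_thetaTranslate`). This character is periodic. Restricting `Jf` to the
cosets of `ℤⁿ` therefore represents `f` by a square integrable field of vectors of `ℓ²(ℤⁿ)` over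
the torus `(ℝ/ℤ)ⁿ` (`torusFiber`), isometrically, and on each fiber `T_k^θ` acts as a scalar. The
problem becomes one about finitely many vectors in a Hilbert space, solved over each point of the
torus separately.

*Lower bound.* A finite combination of `θ`-shifts of `ψ_1, …, ψ_r` has its fibers in the span of
the `r` fibers of the `ψ_i`. By the Eckart–Young inequality (`sum_gram_eigenvalue_tail_le`) the
fibers of `f_1, …, f_m` cannot be approximated from there with squared error below the sum of the
eigenvalues of their Gram matrix beyond the `ℓ`-th. Integrating, and approximating the
projections by finite combinations, gives `IsGramEigensystem.tail_le_approxError`.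

*Optimal generators.* The `ℓ` generators are those whose fibers are the normalized principal
vectors `μ_k^{-1/2} ∑ y_k(i) τf_i`, for eigenvectors `y_k` of the Gram matrix. For this the
eigenvectors must depend measurably on the point (`exists_measurable_eigenbasis`): the limit of
power iteration is a Borel selection of an eigenvector for the largest eigenvalue, and deflation
produces the others. The fibers of these generators are orthonormal or zero. Since the inner
products of `h` with the shifts of a generator `φ` are the Fourier coefficients of `x ↦ ⟨τφ(x),
τh(x)⟩`, Parseval's identity on the torus shows that the shifts form a Parseval frame
(`isParsevalFrameFor_thetaShifts`), and computes the error as the integral of the remaining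
eigenvalues (`IsGramEigensystem.exists_optimal`).

The fiber map `thetaFiber` lives on the cube `[0, |sin θ|]ⁿ`; the map `ω ↦ ω / sin θ` modulo `ℤⁿ`
identifies it with the torus, up to the factor `|sin θ|ⁿ` in the measure, its inverse in the Gram
matrix, and a shift of the index in `ℤⁿ` (`ae_thetaGramian_eq`).
-/

noncomputable section

open Filter Topology InnerProductSpace Polynomial

/-! ### Borel choice of a top eigenvector -/

section PositiveOperators

variable {E : Type*} [NormedAddCommGroup E] [InnerProductSpace ℂ E] [FiniteDimensional ℂ E]

theorem exists_unit_eigenvector_norm {T : E →L[ℂ] E} (hT : T.IsPositive) (h0 : T ≠ 0) :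
    ∃ b : E, ‖b‖ = 1 ∧ T b = (‖T‖ : ℂ) • b := by
  have : Nontrivial (E →L[ℂ] E) := ⟨T, 0, h0⟩
  have : CompleteSpace E := FiniteDimensional.complete ℂ E
  have h := CStarAlgebra.norm_mem_spectrum_of_nonneg
    ((ContinuousLinearMap.nonneg_iff_isPositive T).2 hT)
  replace h : (‖T‖ : ℂ) ∈ spectrum ℂ T := by
    simpa using spectrum.algebraMap_mem ℂ h
  rw [ContinuousLinearMap.spectrum_eq, ← Module.End.hasEigenvalue_iff_mem_spectrum] at h
  obtain ⟨b, hb⟩ := h.exists_hasEigenvector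
  have hn : ‖b‖ ≠ 0 := norm_ne_zero_iff.2 hb.2
  have hTb : T b = (‖T‖ : ℂ) • b := hb.apply_eq_smul
  refine ⟨(‖b‖⁻¹ : ℂ) • b, ?_, ?_⟩
  · rw [norm_smul]; simp [hn]
  · rw [map_smul, hTb, smul_comm]

/-- The powers of a positive contraction converge pointwise: in an eigenbasis they act by powers of
numbers in `[0, 1]`. -/
theorem exists_tendsto_pow_apply {S : E →L[ℂ] E} (hS : S.IsPositive) (h1 : ‖S‖ ≤ 1) (x : E) :
    ∃ y, Tendsto (fun p : ℕ => (S ^ p) x) atTop (𝓝 y) := by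
  let b := hS.isSymmetric.eigenvectorBasis rfl
  let μ := hS.isSymmetric.eigenvalues rfl
  have hb : ∀ i, S (b i) = (μ i : ℂ) • b i := hS.isSymmetric.apply_eigenvectorBasis rfl
  have hμ0 : ∀ i, 0 ≤ μ i :=
    LinearMap.IsPositive.nonneg_eigenvalues
      ((ContinuousLinearMap.isPositive_toLinearMap_iff S).2 hS) rfl
  have hμ1 : ∀ i, μ i ≤ 1 := fun i => by
    have h := S.le_opNorm (b i)
    rw [hb, norm_smul, b.orthonormal.1 i, mul_one, mul_one, Complex.norm_real, Real.norm_eq_abs,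
      abs_of_nonneg (hμ0 i)] at h
    exact h.trans h1
  have hpow : ∀ (p : ℕ) i, (S ^ p) (b i) = ((μ i : ℂ) ^ p) • b i := fun p i => by
    induction p with
    | zero => simp
    | succ p ih => rw [pow_succ, mul_apply_eq_comp, hb, map_smul, ih, smul_smul, pow_succ']
  have hx : ∀ p : ℕ, (S ^ p) x = ∑ i, b.repr x i • (((μ i : ℂ) ^ p) • b i) := fun p => by
    conv_lhs => rw [← b.sum_repr x, map_sum]
    simp [hpow]
  have hlim : ∀ i, ∃ c : ℂ, Tendsto (fun p : ℕ => (μ i : ℂ) ^ p) atTop (𝓝 c) := fun i => by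
    rcases (hμ1 i).lt_or_eq with h | h
    · refine ⟨0, tendsto_pow_atTop_nhds_zero_of_norm_lt_one ?_⟩
      rwa [Complex.norm_real, Real.norm_eq_abs, abs_of_nonneg (hμ0 i)]
    · exact ⟨1, by simp [h]⟩
  choose c hc using hlim
  refine ⟨∑ i, b.repr x i • (c i • b i), ?_⟩
  simp_rw [hx]
  exact tendsto_finsetSum _ fun i _ => ((hc i).smul_const _).const_smul _

end PositiveOperators

/-- A finite family of measurable functions admits a measurable selection of one that satisfies a
measurable condition, wherever some member does. -/
theorem exists_measurable_select {α β ι : Type*} [MeasurableSpace α] [MeasurableSpace β]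
    [Nonempty β] (s : Finset ι) (f : ι → α → β) (hf : ∀ i, Measurable (f i)) (S : ι → Set α)
    (hS : ∀ i, MeasurableSet (S i)) :
    ∃ g : α → β, Measurable g ∧ ∀ x, (∃ i ∈ s, x ∈ S i) → ∃ i ∈ s, x ∈ S i ∧ g x = f i x := by
  classical
  induction s using Finset.induction_on with
  | empty => exact ⟨fun _ => Classical.arbitrary β, measurable_const, by simp⟩
  | insert a s _ ih =>
    obtain ⟨g, hg, h⟩ := ih
    refine ⟨(S a).piecewise (f a) g, (hf a).piecewise (hS a) hg, fun x hx => ?_⟩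
    by_cases hxa : x ∈ S a
    · exact ⟨a, Finset.mem_insert_self _ _, hxa, Set.piecewise_eq_of_mem _ _ _ hxa⟩
    · obtain ⟨i, hi, hxi⟩ := hx
      have hi' : i ∈ s := (Finset.mem_insert.1 hi).resolve_left fun e => hxa (e ▸ hxi)
      obtain ⟨j, hj, hxj, e⟩ := h x ⟨i, hi', hxi⟩
      exact ⟨j, Finset.mem_insert_of_mem hj, hxj, by
        rw [Set.piecewise_eq_of_notMem _ _ _ hxa, e]⟩

section Borel

variable {m : ℕ}

local notation "𝓗" => EuclideanSpace ℂ (Fin m)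

/-- A unit eigenvector for the largest eigenvalue of a positive operator can be chosen as a Borel
function of the operator: normalize a nonzero limit of power iteration, started at a coordinate
vector. -/
theorem exists_measurable_topEigenvector :
    ∃ g : (𝓗 →L[ℂ] 𝓗) → 𝓗, Measurable g ∧
      ∀ T : 𝓗 →L[ℂ] 𝓗, T.IsPositive → T ≠ 0 → ‖g T‖ = 1 ∧ T (g T) = (‖T‖ : ℂ) • g T := by
  let e : Fin m → 𝓗 := EuclideanSpace.basisFun (Fin m) ℂ
  let L : Fin m → (𝓗 →L[ℂ] 𝓗) → 𝓗 := fun c T =>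
    limUnder atTop fun p : ℕ => (((‖T‖⁻¹ : ℂ) • T) ^ p) (e c)
  have hL : ∀ c, Measurable (L c) := fun c => by
    refine (StronglyMeasurable.limUnder fun p => Measurable.stronglyMeasurable ?_).measurable
    have h1 : Measurable fun T : 𝓗 →L[ℂ] 𝓗 => (‖T‖⁻¹ : ℂ) • T := by fun_prop
    have h2 : Continuous fun T : 𝓗 →L[ℂ] 𝓗 => (T ^ p) (e c) := by fun_prop
    exact h2.measurable.comp h1
  obtain ⟨g, hg, h⟩ := exists_measurable_select Finset.univ L hL (fun c => {T | L c T ≠ 0})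
    fun c => (measurableSet_eq_fun (hL c) measurable_const).compl
  refine ⟨fun T => (‖g T‖⁻¹ : ℂ) • g T, by fun_prop, fun T hT h0 => ?_⟩
  have hn : (‖T‖ : ℂ) ≠ 0 := by simpa using h0
  set S : 𝓗 →L[ℂ] 𝓗 := (‖T‖⁻¹ : ℂ) • T with hSdef
  have hS : S.IsPositive := hT.smul_of_nonneg (by
    rw [← Complex.ofReal_inv]; exact_mod_cast inv_nonneg.2 (norm_nonneg T))
  have hS1 : ‖S‖ ≤ 1 := by
    rw [hSdef, norm_smul]; simp [norm_ne_zero_iff.2 h0]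
  choose y hy using exists_tendsto_pow_apply hS hS1
  have hLy : ∀ c, L c T = y (e c) := fun c => (hy (e c)).limUnder_eq
  have hSy : ∀ x, S (y x) = y x := fun x => by
    refine tendsto_nhds_unique (((S.continuous.tendsto _).comp (hy x))) ?_
    refine ((tendsto_add_atTop_iff_nat 1).2 (hy x)).congr fun p => ?_
    rw [pow_succ', mul_apply_eq_comp]; rfl
  have hex : ∃ c ∈ Finset.univ, T ∈ {T | L c T ≠ 0} := by
    by_contra hcon
    push Not at hcon
    obtain ⟨b, hb1, hb⟩ := exists_unit_eigenvector_norm hT h0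
    have hSb : ∀ p : ℕ, (S ^ p) b = b := fun p => by
      induction p with
      | zero => simp
      | succ p ih =>
        rw [pow_succ, mul_apply_eq_comp, hSdef, smul_apply, hb,
          smul_smul, inv_mul_cancel₀ hn, one_smul, ← hSdef, ih]
    have hlim : Tendsto (fun p : ℕ => (S ^ p) b) atTop (𝓝 0) := by
      have hbe : ∀ p : ℕ, (S ^ p) b = ∑ c, b c • (S ^ p) (e c) := fun p => by
        conv_lhs => rw [← (EuclideanSpace.basisFun (Fin m) ℂ).sum_repr b, map_sum]
        simp [e]
      simp_rw [hbe]
      have := tendsto_finsetSum Finset.univ fun (c : Fin m) _ => (hy (e c)).const_smul (b c)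
      refine this.trans (le_of_eq ?_)
      congr 1
      refine Finset.sum_eq_zero fun c _ => ?_
      have := hcon c (Finset.mem_univ c)
      rw [Set.mem_ofPred_eq, not_not, hLy] at this
      rw [this, smul_zero]
    simp_rw [hSb] at hlim
    have := tendsto_nhds_unique hlim tendsto_const_nhds
    rw [← this] at hb1
    simp at hb1
  obtain ⟨c, -, hc, hgc⟩ := h T hex
  have hgn : ‖g T‖ ≠ 0 := by rw [hgc]; exact norm_ne_zero_iff.2 hc
  have hTg : T (g T) = (‖T‖ : ℂ) • g T := by
    rw [hgc, hLy]
    conv_rhs => rw [← hSy, hSdef, smul_apply, smul_smul, mul_inv_cancel₀ hn,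
      one_smul]
  refine ⟨?_, ?_⟩
  · rw [norm_smul]; simp [hgn]
  · rw [map_smul, hTg, smul_comm]

end Borel

/-! ### Measurable diagonalization by deflation -/

section Deflation

theorem continuous_rankOne_self {E : Type*} [NormedAddCommGroup E] [InnerProductSpace ℂ E] :
    Continuous fun x : E => rankOne ℂ x x := by
  have h1 : Continuous fun x : E => ContinuousLinearMap.smulRightL ℂ E E (innerSL ℂ x) :=
    (ContinuousLinearMap.smulRightL ℂ E E).continuous.comp (innerSL ℂ).continuous
  exact h1.clm_apply continuous_id

variable {E : Type*} [NormedAddCommGroup E] [InnerProductSpace ℂ E]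

/-- Successive deflations of an operator `T`: the `k + 1`-st is obtained from the `k`-th, `D`, by
subtracting the rank one operator `‖D‖ ⟨v, ·⟩ v`, where `v = g D`. -/
def deflation (g : (E →L[ℂ] E) → E) (T : E →L[ℂ] E) : ℕ → (E →L[ℂ] E)
  | 0 => T
  | k + 1 => deflation g T k -
      (‖deflation g T k‖ : ℂ) • rankOne ℂ (g (deflation g T k)) (g (deflation g T k))

/-- Deflating a positive operator by a top eigenvector amounts to compressing it to the orthogonal
complement of that vector. -/
theorem deflate_isPositive_and_norm_le [CompleteSpace E] {D : E →L[ℂ] E} (hD : D.IsPositive) {v : E}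
    (hv : ‖v‖ = 1) (hDv : D v = (‖D‖ : ℂ) • v) :
    (D - (‖D‖ : ℂ) • rankOne ℂ v v).IsPositive ∧ ‖D - (‖D‖ : ℂ) • rankOne ℂ v v‖ ≤ ‖D‖ := by
  have hvv : inner ℂ v v = 1 := by rw [inner_self_eq_norm_sq_to_K, hv]; simp
  have hvD : ∀ x, inner ℂ v (D x) = (‖D‖ : ℂ) * inner ℂ v x := fun x => by
    rw [← hD.inner_left_eq_inner_right, hDv, inner_smul_left, Complex.conj_ofReal]
  let P : E →L[ℂ] E := 1 - rankOne ℂ v v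
  have hPsa : ContinuousLinearMap.adjoint P = P := by
    refine (ContinuousLinearMap.eq_adjoint_iff P P).2 (fun x y => ?_) |>.symm
    simp only [P, sub_apply, one_apply_eq_self, rankOne_apply, inner_sub_left, inner_sub_right,
      inner_smul_left, inner_smul_right, inner_conj_symm]
    ring
  have hpos := hD.conj_adjoint P
  have hEq : P ∘L D ∘L ContinuousLinearMap.adjoint P = D - (‖D‖ : ℂ) • rankOne ℂ v v := by
    rw [hPsa]
    ext x
    simp only [P, ContinuousLinearMap.comp_apply, sub_apply, smul_apply, rankOne_apply,
      one_apply_eq_self, map_sub, map_smul, hDv, hvD, hvv]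
    module
  rw [hEq] at hpos
  refine ⟨hpos, (CStarAlgebra.norm_le_norm_of_nonneg_of_le
    ((ContinuousLinearMap.nonneg_iff_isPositive _).2 hpos) ?_)⟩
  rw [ContinuousLinearMap.le_def, sub_sub_cancel]
  exact (isPositive_rankOne_self v).smul_of_nonneg (by exact_mod_cast norm_nonneg D)

theorem deflation_eq_sub_sum (g : (E →L[ℂ] E) → E) (T : E →L[ℂ] E) (k : ℕ) :
    deflation g T k = T - ∑ j ∈ Finset.range k,
      (‖deflation g T j‖ : ℂ) • rankOne ℂ (g (deflation g T j)) (g (deflation g T j)) := by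
  induction k with
  | zero => simp [deflation]
  | succ k ih =>
    rw [Finset.sum_range_succ, ← sub_sub, ← ih]
    rfl

variable [FiniteDimensional ℂ E] {g : (E →L[ℂ] E) → E}

/-- As long as no deflation vanishes, the deflations stay positive, kill the vectors split off
before, and have decreasing norms; the vectors split off are orthogonal, because each is in the
range of a symmetric operator that kills the earlier ones. -/
theorem deflation_invariants
    (hg : ∀ D : E →L[ℂ] E, D.IsPositive → D ≠ 0 → ‖g D‖ = 1 ∧ D (g D) = (‖D‖ : ℂ) • g D)
    {T : E →L[ℂ] E} (hT : T.IsPositive) {k : ℕ} (hk : ∀ j < k, deflation g T j ≠ 0) :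
    (deflation g T k).IsPositive ∧ (∀ j < k, deflation g T k (g (deflation g T j)) = 0) ∧
      (∀ j < k, ‖deflation g T (j + 1)‖ ≤ ‖deflation g T j‖) ∧
      (∀ i < k, ∀ j < i, inner ℂ (g (deflation g T j)) (g (deflation g T i)) = 0) := by
  have : CompleteSpace E := FiniteDimensional.complete ℂ E
  induction k with
  | zero => exact ⟨hT, by simp, by simp, by simp⟩
  | succ k ih =>
    obtain ⟨hpos, hker, hnorm, hort⟩ := ih fun j hj => hk j (by omega)
    have hk0 := hk k (by omega)
    obtain ⟨h1, h2⟩ := hg _ hpos hk0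
    have hvv : inner ℂ (g (deflation g T k)) (g (deflation g T k)) = 1 := by
      rw [inner_self_eq_norm_sq_to_K, h1]; simp
    have hortk : ∀ j < k, inner ℂ (g (deflation g T j)) (g (deflation g T k)) = 0 := fun j hj => by
      have h := hpos.inner_left_eq_inner_right (g (deflation g T j)) (g (deflation g T k))
      rw [hker j hj, inner_zero_left, h2, inner_smul_right] at h
      exact (mul_eq_zero.1 h.symm).resolve_left (by simpa using hk0)
    obtain ⟨hp, hn⟩ := deflate_isPositive_and_norm_le hpos h1 h2
    refine ⟨hp, fun j hj => ?_, fun j hj => ?_, fun i hi j hj => ?_⟩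
    · simp only [deflation, sub_apply, smul_apply, rankOne_apply]
      rcases Nat.lt_succ_iff_lt_or_eq.1 hj with hj | rfl
      · rw [hker j hj, ← inner_conj_symm, hortk j hj]; simp
      · rw [h2, hvv]; simp
    · rcases Nat.lt_succ_iff_lt_or_eq.1 hj with hj | rfl
      · exact hnorm j hj
      · exact hn
    · rcases Nat.lt_succ_iff_lt_or_eq.1 hi with hi | rfl
      · exact hort i hi j hj
      · exact hortk j hj

/-- An injective operator on a space of dimension `> k` is not a sum of `k` rank one operators. -/
theorem deflation_ne_zero (g : (E →L[ℂ] E) → E) {T : E →L[ℂ] E} (hT : Function.Injective T) {k : ℕ}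
    (hk : k < Module.finrank ℂ E) : deflation g T k ≠ 0 := fun h => by
  rw [deflation_eq_sub_sum, sub_eq_zero] at h
  let v : Fin k → E := fun j => g (deflation g T j)
  have hr : LinearMap.range (T : E →ₗ[ℂ] E) ≤ Submodule.span ℂ (Set.range v) := by
    rintro _ ⟨x, rfl⟩
    rw [ContinuousLinearMap.coe_coe, h, sum_apply]
    refine Submodule.sum_mem _ fun j hj => ?_
    rw [smul_apply, rankOne_apply]
    exact Submodule.smul_mem _ _ (Submodule.smul_mem _ _
      (Submodule.subset_span ⟨⟨j, Finset.mem_range.1 hj⟩, rfl⟩))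
  have h1 := Submodule.finrank_mono hr
  rw [LinearMap.finrank_range_of_inj hT] at h1
  have h2 := finrank_range_le_card (R := ℂ) v
  rw [Set.finrank, Fintype.card_fin] at h2
  omega

/-- Deflation diagonalizes a positive definite operator: the vectors split off form an orthonormal
family of eigenvectors, the eigenvalues are the successive norms and decrease. -/
theorem deflation_eigenvectors
    (hg : ∀ D : E →L[ℂ] E, D.IsPositive → D ≠ 0 → ‖g D‖ = 1 ∧ D (g D) = (‖D‖ : ℂ) • g D)
    {T : E →L[ℂ] E} (hT : T.IsPositive) (hinj : Function.Injective T) {m : ℕ}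
    (hm : Module.finrank ℂ E = m) :
    Orthonormal ℂ (fun i : Fin m => g (deflation g T i)) ∧
      (∀ i : Fin m, T (g (deflation g T i)) = (‖deflation g T i‖ : ℂ) • g (deflation g T i)) ∧
      Antitone fun i : Fin m => ‖deflation g T i‖ := by
  have hne : ∀ k < m, deflation g T k ≠ 0 := fun k hk => deflation_ne_zero g hinj (hm ▸ hk)
  obtain ⟨-, -, hnorm, hort⟩ := deflation_invariants hg hT (k := m) hne
  have hinv := fun (k : ℕ) (hk : k < m) =>
    deflation_invariants hg hT (k := k) fun j hj => hne j (hj.trans hk)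
  refine ⟨⟨fun i => (hg _ (hinv i i.2).1 (hne i i.2)).1, fun i j hij => ?_⟩, fun i => ?_, ?_⟩
  · rcases lt_or_gt_of_ne (Fin.val_ne_of_ne hij) with h | h
    · exact hort j j.2 i h
    · show inner ℂ _ _ = 0
      rw [← inner_conj_symm, hort i i.2 j h, map_zero]
  · have h := (hg _ (hinv i i.2).1 (hne i i.2)).2
    have h' := congrArg (fun S : E →L[ℂ] E => S (g (deflation g T i)))
      (deflation_eq_sub_sum g T i)
    simp only [sub_apply, sum_apply] at h'
    rw [Finset.sum_eq_zero, sub_zero] at h'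
    · rw [← h', h]
    · intro j hj
      rw [smul_apply, rankOne_apply, hort i i.2 j (Finset.mem_range.1 hj), zero_smul, smul_zero]
  · intro i j hij
    have key : ∀ a b : ℕ, a ≤ b → b < m → ‖deflation g T b‖ ≤ ‖deflation g T a‖ := fun a b hab => by
      induction b, hab using Nat.le_induction with
      | base => intro _; exact le_rfl
      | succ b _ ih => intro hb; exact (hnorm b (by omega)).trans (ih (by omega))
    exact key i j hij j.2

end Deflation

/-- Measurable diagonalization: the decreasing eigenvalues of a positive operator on `ℂᵐ`, and an
orthonormal basis of eigenvectors, can be chosen as Borel functions of the operator. -/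
theorem exists_measurable_eigenbasis (m : ℕ) :
    ∃ (Λ : Fin m → (EuclideanSpace ℂ (Fin m) →L[ℂ] EuclideanSpace ℂ (Fin m)) → ℝ)
      (v : Fin m → (EuclideanSpace ℂ (Fin m) →L[ℂ] EuclideanSpace ℂ (Fin m)) →
        EuclideanSpace ℂ (Fin m)),
      (∀ i, Measurable (Λ i)) ∧ (∀ i, Measurable (v i)) ∧ ∀ T, T.IsPositive →
        Orthonormal ℂ (fun i => v i T) ∧ (∀ i, T (v i T) = (Λ i T : ℂ) • v i T) ∧
          Antitone fun i => Λ i T := by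
  obtain ⟨g, hgm, hg⟩ := exists_measurable_topEigenvector (m := m)
  have hm : ∀ k : ℕ, Measurable fun T => deflation g T k := fun k => by
    induction k with
    | zero => exact measurable_id
    | succ k ih =>
      have h2 : Measurable fun T => rankOne ℂ (g (deflation g T k)) (g (deflation g T k)) :=
        continuous_rankOne_self.measurable.comp (hgm.comp ih)
      have h3 : Measurable fun T => (‖deflation g T k‖ : ℂ) := by fun_prop
      exact ih.sub (h3.smul h2)
  -- The shift by the identity makes the operator invertible, so that no deflation vanishes early.
  have hs : ∀ i : ℕ, Measurable fun T : EuclideanSpace ℂ (Fin m) →L[ℂ] EuclideanSpace ℂ (Fin m) =>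
      deflation g (T + 1) i := fun i =>
    (hm i).comp (measurable_id.add_const 1)
  refine ⟨fun (i : Fin m) T => ‖deflation g (T + 1) i‖ - 1,
    fun (i : Fin m) T => g (deflation g (T + 1) i),
    fun i => (hs i).norm.sub_const 1, fun i => hgm.comp (hs i), fun T hT => ?_⟩
  have hpos : (T + 1).IsPositive := hT.add ContinuousLinearMap.isPositive_one
  have hinj : Function.Injective ⇑(T + 1) := by
    refine (injective_iff_map_eq_zero _).2 fun x hx => ?_
    have h := hT.re_inner_nonneg_left x
    have h2 : T x = -x := by
      rw [add_apply, one_apply_eq_self] at hx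
      exact eq_neg_of_add_eq_zero_left hx
    rw [h2, inner_neg_left, map_neg, inner_self_eq_norm_sq] at h
    exact norm_eq_zero.1 (pow_eq_zero_iff two_ne_zero |>.1
      (le_antisymm (by linarith) (sq_nonneg _)))
  obtain ⟨h1, h2, h3⟩ := deflation_eigenvectors hg hpos hinj (m := m) (by simp)
  refine ⟨h1, fun i => ?_, fun i j hij => sub_le_sub_right (h3 hij) 1⟩
  have := h2 i
  rw [add_apply, one_apply_eq_self] at this
  rw [Complex.ofReal_sub, sub_smul, ← this]
  simp

/-- The sorted eigenvalues of a Hermitian matrix are determined by its characteristic polynomial. -/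
theorem Matrix.IsHermitian.eigenvalues₀_eq_of_charpoly {m : ℕ} {A : Matrix (Fin m) (Fin m) ℂ}
    (hA : A.IsHermitian) {μ : Fin m → ℝ} (hμ : Antitone μ)
    (h : A.charpoly = ∏ i, (X - C (μ i : ℂ))) (i : Fin m) :
    hA.eigenvalues₀ (Fin.cast (Fintype.card_fin m).symm i) = μ i := by
  have hs := hA.sort_roots_charpoly_eq_eigenvalues₀
  have hr : (∏ i, (X - C (μ i : ℂ))).roots = Multiset.map (fun i => (μ i : ℂ)) Finset.univ.val := by
    rw [roots_prod _ _ (by simp [Finset.prod_ne_zero_iff, X_sub_C_ne_zero])]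
    simp
  have hl : List.ofFn μ = List.ofFn hA.eigenvalues₀ := by
    rw [← hs, h, hr, Multiset.map_map]
    simp only [Fin.univ_val_map, Function.comp_def, Multiset.coe_sort, RCLike.re_to_complex,
      Complex.ofReal_re]
    refine (List.mergeSort_of_pairwise ?_).symm
    simp_rw [decide_eq_true_eq, ← List.sortedGE_iff_pairwise]
    exact hμ.sortedGE_ofFn
  have := congrArg (fun l : List ℝ => l[(i : ℕ)]?) hl
  simpa [List.getElem?_ofFn] using this.symm

/-- An orthonormal eigenbasis gives the factorization of the characteristic polynomial, with
multiplicities. -/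
theorem Matrix.charpoly_eq_prod_of_eigenbasis {m : ℕ} {A : Matrix (Fin m) (Fin m) ℂ}
    {v : Fin m → EuclideanSpace ℂ (Fin m)} (hv : Orthonormal ℂ v) {μ : Fin m → ℝ}
    (h : ∀ i, A.mulVec (v i) = (μ i : ℂ) • (v i).ofLp) :
    A.charpoly = ∏ i, (X - C (μ i : ℂ)) := by
  let U : Matrix (Fin m) (Fin m) ℂ := Matrix.of fun i j => v j i
  have hU : U.conjTranspose * U = 1 := by
    ext i j
    rw [Matrix.one_apply, ← orthonormal_iff_ite.1 hv i j, Matrix.mul_apply]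
    simp [U, PiLp.inner_apply, mul_comm]
  have hU' : U * U.conjTranspose = 1 := mul_eq_one_comm.1 hU
  have hAU : A * U = U * Matrix.diagonal fun i => (μ i : ℂ) := by
    ext i j
    have := congrFun (h j) i
    rw [Matrix.mul_diagonal, Matrix.mul_apply]
    simpa [Matrix.mulVec, dotProduct, U, mul_comm] using this
  have hA : A = U * (Matrix.diagonal (fun i => (μ i : ℂ)) * U.conjTranspose) := by
    rw [← mul_assoc, ← hAU, mul_assoc, hU', mul_one]
  rw [hA, Matrix.charpoly_mul_comm, mul_assoc, hU, mul_one, Matrix.charpoly_diagonal]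

/-! ### Gram matrices and the Eckart–Young inequality -/

section PartialOrthonormal

variable {K : Type*} [NormedAddCommGroup K] [InnerProductSpace ℂ K]

/-- A family of pairwise orthogonal vectors each of which is a unit vector or zero. -/
def OrthonormalOrZero {ι : Type*} (q : ι → K) : Prop :=
  (∀ j k, j ≠ k → inner ℂ (q j) (q k) = 0) ∧ ∀ k, q k = 0 ∨ ‖q k‖ = 1

variable {ι : Type*} [Fintype ι] {q : ι → K}

/-- The orthogonal projection of `s` to the span of the `q_k` is `∑ ⟨q_k, s⟩ q_k`. -/
theorem OrthonormalOrZero.exists_projection (hq : OrthonormalOrZero q) (s : K) :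
    ∃ y ∈ Submodule.span ℂ (Set.range q),
      (∀ z ∈ Submodule.span ℂ (Set.range q), inner ℂ z (s - y) = 0) ∧
        ∑ k, ‖inner ℂ (q k) s‖ ^ 2 = ‖y‖ ^ 2 := by
  classical
  set y := ∑ k, inner ℂ (q k) s • q k with hy
  have hys : y ∈ Submodule.span ℂ (Set.range q) :=
    Submodule.sum_mem _ fun k _ => Submodule.smul_mem _ _ (Submodule.subset_span ⟨k, rfl⟩)
  have h1 : ∀ j, inner ℂ (q j) (s - y) = 0 := fun j => by
    rw [inner_sub_right, hy, inner_sum, Finset.sum_eq_single j]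
    · rw [inner_smul_right]
      rcases hq.2 j with h | h
      · simp [h]
      · rw [inner_self_eq_norm_sq_to_K, h]; simp
    · intro k _ hk
      rw [inner_smul_right, hq.1 j k hk.symm, mul_zero]
    · simp
  have h2 : ∀ z ∈ Submodule.span ℂ (Set.range q), inner ℂ z (s - y) = 0 := fun z hz => by
    induction hz using Submodule.span_induction with
    | mem z hz => obtain ⟨j, rfl⟩ := hz; exact h1 j
    | zero => simp
    | add a b _ _ ha hb => rw [inner_add_left, ha, hb, add_zero]
    | smul c a _ ha => rw [inner_smul_left, ha, mul_zero]
  refine ⟨y, hys, h2, ?_⟩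
  have h6 : inner ℂ y y = inner ℂ y s := by
    have h := h2 y hys
    rw [inner_sub_right, sub_eq_zero] at h
    exact h.symm
  have h7 : ((∑ k, ‖inner ℂ (q k) s‖ ^ 2 : ℝ) : ℂ) = ((‖y‖ ^ 2 : ℝ) : ℂ) := by
    have := inner_self_eq_norm_sq_to_K (𝕜 := ℂ) y
    rw [h6] at this
    push_cast
    simp only [Complex.coe_algebraMap] at this
    rw [← this, hy, sum_inner]
    refine Finset.sum_congr rfl fun k _ => ?_
    rw [inner_smul_left, Complex.conj_mul']
  exact_mod_cast h7

/-- `‖s‖² - ∑ |⟨q_k, s⟩|²` is the squared distance from `s` to the span of the `q_k`. -/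
theorem OrthonormalOrZero.norm_sq_sub_sum_le (hq : OrthonormalOrZero q) (s : K) {b : K}
    (hb : b ∈ Submodule.span ℂ (Set.range q)) :
    ‖s‖ ^ 2 - ∑ k, ‖inner ℂ (q k) s‖ ^ 2 ≤ ‖s - b‖ ^ 2 := by
  obtain ⟨y, hy, hort, hsum⟩ := hq.exists_projection s
  have h3 := norm_add_sq_eq_norm_sq_add_norm_sq_of_inner_eq_zero (𝕜 := ℂ) y (s - y) (hort y hy)
  have h4 := norm_add_sq_eq_norm_sq_add_norm_sq_of_inner_eq_zero (𝕜 := ℂ) (y - b) (s - y)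
    (hort _ (Submodule.sub_mem _ hy hb))
  rw [add_sub_cancel] at h3
  rw [show y - b + (s - y) = s - b by abel] at h4
  nlinarith [mul_self_nonneg ‖y - b‖]

theorem OrthonormalOrZero.sum_le (hq : OrthonormalOrZero q) (s : K) :
    ∑ k, ‖inner ℂ (q k) s‖ ^ 2 ≤ ‖s‖ ^ 2 := by
  obtain ⟨y, hy, hort, hsum⟩ := hq.exists_projection s
  have h3 := norm_add_sq_eq_norm_sq_add_norm_sq_of_inner_eq_zero (𝕜 := ℂ) y (s - y) (hort y hy)
  rw [add_sub_cancel] at h3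
  nlinarith [mul_self_nonneg ‖s - y‖]

end PartialOrthonormal

/-- A linear form with decreasing nonnegative coefficients `μ_k`, on weights in `[0, 1]` of total
mass at most `ℓ`, is largest when the first `ℓ` weights are `1`. -/
theorem sum_tail_le_of_antitone {m ℓ : ℕ} {μ t : Fin m → ℝ} (hμ : Antitone μ) (hμ0 : ∀ k, 0 ≤ μ k)
    (ht0 : ∀ k, 0 ≤ t k) (ht1 : ∀ k, t k ≤ 1) (hsum : ∑ k, t k ≤ ℓ) :
    ∑ k ∈ Finset.univ.filter (fun k : Fin m => ℓ ≤ (k : ℕ)), μ k ≤ ∑ k, μ k * (1 - t k) := by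
  rcases le_or_gt m ℓ with h | h
  · rw [Finset.filter_false_of_mem fun k _ => by have := k.2; omega, Finset.sum_empty]
    exact Finset.sum_nonneg fun k _ => mul_nonneg (hμ0 k) (by linarith [ht1 k])
  · set c := μ ⟨ℓ, h⟩ with hc
    have hcard : ∑ k : Fin m, (if (k : ℕ) < ℓ then (1 : ℝ) else 0) = ℓ := by
      rw [Finset.sum_boole, Fin.card_filter_val_lt]
      simp [h.le]
    have hterm : ∀ k : Fin m, c * ((if (k : ℕ) < ℓ then (1 : ℝ) else 0) - t k) ≤
        μ k * (1 - t k) - if ℓ ≤ (k : ℕ) then μ k else 0 := fun k => by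
      rcases lt_or_ge (k : ℕ) ℓ with hk | hk
      · rw [if_pos hk, if_neg (by omega), sub_zero]
        exact mul_le_mul_of_nonneg_right (hμ (Fin.le_def.2 hk.le)) (by linarith [ht1 k])
      · rw [if_neg (by omega), if_pos hk]
        have := mul_le_mul_of_nonneg_right (hμ (Fin.le_def.2 hk : (⟨ℓ, h⟩ : Fin m) ≤ k)) (ht0 k)
        linarith
    have := Finset.sum_le_sum fun k (_ : k ∈ Finset.univ) => hterm k
    rw [← Finset.mul_sum, Finset.sum_sub_distrib, Finset.sum_sub_distrib, hcard,
      ← Finset.sum_filter] at this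
    have h2 : 0 ≤ c * (ℓ - ∑ k, t k) := mul_nonneg (hμ0 _) (by linarith)
    linarith

section GramEigenvectors

variable {K : Type*} [NormedAddCommGroup K] [InnerProductSpace ℂ K] {m : ℕ}
  {x : Fin m → EuclideanSpace ℂ (Fin m)}

theorem Orthonormal.sum_conj_mul_eq_ite (hx : Orthonormal ℂ x) (i j : Fin m) :
    ∑ k, star (x k i) * x k j = if i = j then 1 else 0 := by
  -- The matrix with columns `x_k` is unitary, so its rows are orthonormal too.
  let U : Matrix (Fin m) (Fin m) ℂ := Matrix.of fun i j => x j i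
  have hU : U.conjTranspose * U = 1 := by
    ext i j
    rw [Matrix.one_apply, ← orthonormal_iff_ite.1 hx i j, Matrix.mul_apply]
    simp [U, PiLp.inner_apply, mul_comm]
  have hU'' : U * U.conjTranspose = 1 := mul_eq_one_comm.1 hU
  have hU' := congrFun (congrFun hU'' j) i
  rw [Matrix.mul_apply, Matrix.one_apply] at hU'
  simp only [U, Matrix.of_apply, Matrix.conjTranspose_apply, mul_comm, eq_comm (a := j)] at hU'
  simpa only [mul_comm] using hU'

/-- Rotating a finite family of vectors by a unitary matrix preserves the sum of the squared
norms. -/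
theorem sum_norm_sq_rotate (hx : Orthonormal ℂ x) (b : Fin m → K) :
    ∑ k, ‖∑ i, x k i • b i‖ ^ 2 = ∑ i, ‖b i‖ ^ 2 := by
  have key : ∑ k, inner ℂ (∑ i, x k i • b i) (∑ i, x k i • b i) = ∑ i, inner ℂ (b i) (b i) := by
    simp_rw [sum_inner, inner_sum, inner_smul_left, inner_smul_right]
    rw [Finset.sum_comm]
    refine Finset.sum_congr rfl fun i _ => ?_
    rw [Finset.sum_comm]
    have : ∀ j, ∑ k, (starRingEnd ℂ) (x k i) * (x k j * inner ℂ (b i) (b j)) =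
        if i = j then inner ℂ (b i) (b j) else 0 := fun j => by
      have h := hx.sum_conj_mul_eq_ite i j
      simp_rw [← mul_assoc, ← Finset.sum_mul, starRingEnd_apply, h]
      split_ifs <;> simp
    simp [this]
  simp_rw [inner_self_eq_norm_sq_to_K] at key
  exact_mod_cast key

/-- For a unit eigenvector `x` of the Gram matrix of `a`, with eigenvalue `μ`, the vector
`μ^{-1/2} ∑ x_i a_i`; it is `0` when `μ = 0`. -/
def principalVector (a : Fin m → K) (x : EuclideanSpace ℂ (Fin m)) (μ : ℝ) : K :=
  (((√μ)⁻¹ : ℝ) : ℂ) • ∑ i, x i • a i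

variable {a : Fin m → K} {μ : Fin m → ℝ}

theorem inner_rotate_of_gram_eigenvector {y : EuclideanSpace ℂ (Fin m)} {r : ℝ}
    (h : (Matrix.gram ℂ a).mulVec y = (r : ℂ) • y.ofLp) (i : Fin m) :
    inner ℂ (a i) (∑ j, y j • a j) = r * y i := by
  have := congrFun h i
  simp only [Matrix.mulVec, dotProduct, Matrix.gram_apply, Pi.smul_apply, smul_eq_mul] at this
  rw [← this, inner_sum]
  simp [inner_smul_right, mul_comm]

theorem inner_rotate_rotate (hx : Orthonormal ℂ x)
    (h : ∀ k, (Matrix.gram ℂ a).mulVec (x k) = (μ k : ℂ) • (x k).ofLp) (j k : Fin m) :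
    inner ℂ (∑ i, x j i • a i) (∑ i, x k i • a i) = if j = k then (μ k : ℂ) else 0 := by
  have h1 := orthonormal_iff_ite.1 hx j k
  rw [sum_inner]
  simp_rw [inner_smul_left, inner_rotate_of_gram_eigenvector (h k)]
  have : ∑ i, (starRingEnd ℂ) (x j i) * (μ k * x k i) = μ k * inner ℂ (x j) (x k) := by
    rw [PiLp.inner_apply, Finset.mul_sum]
    refine Finset.sum_congr rfl fun i _ => ?_
    simp only [RCLike.inner_apply]
    ring
  rw [this, h1]
  split_ifs <;> simp

theorem norm_sq_rotate (hx : Orthonormal ℂ x)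
    (h : ∀ k, (Matrix.gram ℂ a).mulVec (x k) = (μ k : ℂ) • (x k).ofLp) (k : Fin m) :
    ‖∑ i, x k i • a i‖ ^ 2 = μ k := by
  have := inner_rotate_rotate hx h k k
  rw [if_pos rfl, inner_self_eq_norm_sq_to_K] at this
  exact Complex.ofReal_injective (by simpa using this)

theorem gram_eigenvalue_nonneg (hx : Orthonormal ℂ x)
    (h : ∀ k, (Matrix.gram ℂ a).mulVec (x k) = (μ k : ℂ) • (x k).ofLp) (k : Fin m) : 0 ≤ μ k := by
  rw [← norm_sq_rotate hx h k]; positivity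

theorem sum_gram_eigenvalue (hx : Orthonormal ℂ x)
    (h : ∀ k, (Matrix.gram ℂ a).mulVec (x k) = (μ k : ℂ) • (x k).ofLp) :
    ∑ k, μ k = ∑ i, ‖a i‖ ^ 2 := by
  rw [← sum_norm_sq_rotate hx a]
  exact Finset.sum_congr rfl fun k _ => (norm_sq_rotate hx h k).symm

theorem orthonormalOrZero_principalVector (hx : Orthonormal ℂ x)
    (h : ∀ k, (Matrix.gram ℂ a).mulVec (x k) = (μ k : ℂ) • (x k).ofLp) :
    OrthonormalOrZero fun k => principalVector a (x k) (μ k) := by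
  refine ⟨fun j k hjk => ?_, fun k => ?_⟩
  · simp only [principalVector]
    rw [inner_smul_left, inner_smul_right,
      inner_rotate_rotate hx h, if_neg hjk, mul_zero, mul_zero]
  · rcases (gram_eigenvalue_nonneg hx h k).eq_or_lt with h0 | h0
    · left; simp [principalVector, ← h0]
    · right
      have h1 := norm_sq_rotate hx h k
      simp only [principalVector]
      rw [norm_smul, Complex.norm_real, Real.norm_of_nonneg (by positivity)]
      rw [← Real.sqrt_sq (norm_nonneg (∑ i, x k i • a i)), h1]
      exact inv_mul_cancel₀ (Real.sqrt_pos.2 h0).ne'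

theorem smul_principalVector (hx : Orthonormal ℂ x)
    (h : ∀ k, (Matrix.gram ℂ a).mulVec (x k) = (μ k : ℂ) • (x k).ofLp) (k : Fin m) :
    ((√(μ k) : ℝ) : ℂ) • principalVector a (x k) (μ k) = ∑ i, x k i • a i := by
  rcases (gram_eigenvalue_nonneg hx h k).eq_or_lt with h0 | h0
  · have h1 := norm_sq_rotate hx h k
    rw [← h0, sq_eq_zero_iff, norm_eq_zero] at h1
    rw [h1, ← h0]; simp
  · rw [principalVector, smul_smul, ← Complex.ofReal_mul,
      mul_inv_cancel₀ (Real.sqrt_pos.2 h0).ne', Complex.ofReal_one, one_smul]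

theorem sum_norm_sq_inner_principalVector (hx : Orthonormal ℂ x)
    (h : ∀ k, (Matrix.gram ℂ a).mulVec (x k) = (μ k : ℂ) • (x k).ofLp) (k : Fin m) :
    ∑ i, ‖inner ℂ (principalVector a (x k) (μ k)) (a i)‖ ^ 2 = μ k := by
  have h0 := gram_eigenvalue_nonneg hx h k
  have h1 : ∀ i, ‖inner ℂ (principalVector a (x k) (μ k)) (a i)‖ ^ 2 = μ k * ‖x k i‖ ^ 2 := by
    intro i
    rw [← norm_inner_symm, principalVector, inner_smul_right,
      inner_rotate_of_gram_eigenvector (h k), ← mul_assoc, ← Complex.ofReal_mul, norm_mul,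
      Complex.norm_real, mul_pow, Real.norm_eq_abs, sq_abs, mul_pow, inv_pow, Real.sq_sqrt h0]
    rcases h0.eq_or_lt with h0 | h0
    · simp [← h0]
    · field_simp
  simp_rw [h1, ← Finset.mul_sum, ← EuclideanSpace.norm_sq_eq, hx.1 k]
  simp

/-- The Eckart–Young inequality: vectors `a_i` cannot be approximated from a subspace of dimension
at most `ℓ` with smaller total squared error than the sum of the eigenvalues of their Gram matrix
beyond the `ℓ`-th. -/
theorem sum_gram_eigenvalue_tail_le (hx : Orthonormal ℂ x)
    (h : ∀ k, (Matrix.gram ℂ a).mulVec (x k) = (μ k : ℂ) • (x k).ofLp) (hμ : Antitone μ) {ℓ : ℕ}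
    (S : Submodule ℂ K) [FiniteDimensional ℂ S] (hS : Module.finrank ℂ S ≤ ℓ) {b : Fin m → K}
    (hb : ∀ i, b i ∈ S) :
    ∑ k ∈ Finset.univ.filter (fun k : Fin m => ℓ ≤ (k : ℕ)), μ k ≤ ∑ i, ‖a i - b i‖ ^ 2 := by
  have hμ0 := gram_eigenvalue_nonneg hx h
  let s : Fin (Module.finrank ℂ S) → K := fun p => stdOrthonormalBasis ℂ S p
  have hs : Orthonormal ℂ s :=
    (stdOrthonormalBasis ℂ S).orthonormal.comp_linearIsometry S.subtypeₗᵢ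
  have hs' : OrthonormalOrZero s := ⟨fun j k hjk => hs.2 hjk, fun k => Or.inr (hs.1 k)⟩
  have hspan : ∀ z ∈ S, z ∈ Submodule.span ℂ (Set.range s) := fun z hz => by
    have h1 := (stdOrthonormalBasis ℂ S).sum_repr ⟨z, hz⟩
    have h2 := congrArg Subtype.val h1
    simp only [Submodule.coe_sum, Submodule.coe_smul] at h2
    rw [← h2]
    exact Submodule.sum_mem _ fun p _ => Submodule.smul_mem _ _ (Submodule.subset_span ⟨p, rfl⟩)
  set q := fun k => principalVector a (x k) (μ k) with hqdef
  have hq : OrthonormalOrZero q := orthonormalOrZero_principalVector hx h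
  let t : Fin m → ℝ := fun k => ∑ p, ‖inner ℂ (s p) (q k)‖ ^ 2
  have ht0 : ∀ k, 0 ≤ t k := fun k => Finset.sum_nonneg fun p _ => sq_nonneg _
  have ht1 : ∀ k, t k ≤ 1 := fun k => (hs'.sum_le (q k)).trans (by
    rcases hq.2 k with h | h <;> simp [h])
  have hsum : ∑ k, t k ≤ ℓ := by
    rw [Finset.sum_comm]
    calc ∑ p, ∑ k, ‖inner ℂ (s p) (q k)‖ ^ 2 ≤ ∑ _p : Fin (Module.finrank ℂ S), (1 : ℝ) := by
          refine Finset.sum_le_sum fun p _ => ?_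
          have := hq.sum_le (s p)
          rw [hs.1 p, one_pow] at this
          simpa only [norm_inner_symm (s p)] using this
      _ ≤ ℓ := by simpa using hS
  refine (sum_tail_le_of_antitone hμ hμ0 ht0 ht1 hsum).trans ?_
  rw [← sum_norm_sq_rotate hx (fun i => a i - b i)]
  refine Finset.sum_le_sum fun k _ => ?_
  have hbk : ∑ i, x k i • b i ∈ S := Submodule.sum_mem _ fun i _ => Submodule.smul_mem _ _ (hb i)
  have h1 := hs'.norm_sq_sub_sum_le (∑ i, x k i • a i) (hspan _ hbk)
  simp_rw [smul_sub, Finset.sum_sub_distrib]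
  refine le_trans (le_of_eq ?_) h1
  rw [norm_sq_rotate hx h k, ← smul_principalVector hx h k]
  simp_rw [inner_smul_right, norm_mul, Complex.norm_real, mul_pow, Real.norm_eq_abs, sq_abs,
    Real.sq_sqrt (hμ0 k), ← Finset.mul_sum]
  ring

end GramEigenvectors

/-! ### Lebesgue measure on `ℝⁿ` and Haar measure on the torus -/

attribute [local instance] instMeasureSpaceUnitAddCircle

section Periodization

/-- The Fourier series on the torus in Mathlib are stated for the normalized Haar measure of the
circle, the measure theory of `ℝ/ℤ` for the measure of a general `AddCircle`; the two agree. -/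
theorem volume_unitAddCircle_eq :
    (volume : Measure UnitAddCircle) = @volume _ (AddCircle.measureSpace 1) := by
  rw [AddCircle.volume_eq_smul_haarAddCircle, ENNReal.ofReal_one, one_smul]
  rfl

instance isProbabilityMeasure_volume_unitAddCircle :
    IsProbabilityMeasure (volume : Measure UnitAddCircle) :=
  inferInstanceAs (IsProbabilityMeasure AddCircle.haarAddCircle)

variable {n : ℕ}

/-- The quotient map from `ℝⁿ` to the torus `(ℝ/ℤ)ⁿ`. -/
def toTorus (ξ : RSpace n) : UnitAddTorus (Fin n) := fun i => (ξ i : UnitAddCircle)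

/-- The section of `toTorus` with values in the half-open cube `(0, 1]ⁿ`. -/
def torusSection (x : UnitAddTorus (Fin n)) : RSpace n :=
  WithLp.toLp 2 fun i => (AddCircle.equivIoc (1 : ℝ) 0 (x i) : ℝ)

/-- The half-open unit cube `(0, 1]ⁿ`. -/
def unitCube (n : ℕ) : Set (RSpace n) := {ξ | ∀ i, ξ i ∈ Set.Ioc (0 : ℝ) 1}

/-- The bijection `(x, k) ↦ torusSection x + k` from `(ℝ/ℤ)ⁿ × ℤⁿ` to `ℝⁿ`. -/
def torusUnfold (p : UnitAddTorus (Fin n) × (Fin n → ℤ)) : RSpace n :=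
  torusSection p.1 + latticePoint p.2

theorem measurable_toTorus : Measurable (toTorus (n := n)) :=
  measurable_pi_lambda _ fun i => AddCircle.measurable_mk'.comp
    ((measurable_pi_apply i).comp (WithLp.measurable_ofLp 2 _))

theorem measurableSet_cube (a b : ℝ) : MeasurableSet {ξ : RSpace n | ∀ i, ξ i ∈ Set.Ioc a b} := by
  have : {ξ : RSpace n | ∀ i, ξ i ∈ Set.Ioc a b} =
      (WithLp.ofLp : RSpace n → Fin n → ℝ) ⁻¹' Set.univ.pi fun _ => Set.Ioc a b := by
    ext; simp
  rw [this]
  exact WithLp.measurable_ofLp 2 _ (MeasurableSet.univ_pi fun _ => measurableSet_Ioc)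

theorem toTorus_torusSection (x : UnitAddTorus (Fin n)) : toTorus (torusSection x) = x := by
  ext i
  exact (AddCircle.equivIoc (1 : ℝ) 0).symm_apply_apply (x i)

theorem toTorus_add_latticePoint (ξ : RSpace n) (k : Fin n → ℤ) :
    toTorus (ξ + latticePoint k) = toTorus ξ := by
  ext i
  simp [toTorus, latticePoint]

theorem toTorus_torusUnfold (p : UnitAddTorus (Fin n) × (Fin n → ℤ)) :
    toTorus (torusUnfold p) = p.1 := by
  rw [torusUnfold, toTorus_add_latticePoint, toTorus_torusSection]

/-- Each point is the representative in `(0, 1]ⁿ` of its class plus a lattice point. -/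
theorem exists_torusUnfold_eq (ξ : RSpace n) : ∃ k, torusUnfold (toTorus ξ, k) = ξ := by
  have h : ∀ i, ∃ j : ℤ, ξ i - (torusSection (toTorus ξ)) i = j := fun i => by
    have h1 := congrFun (toTorus_torusSection (toTorus ξ)) i
    have h2 : ((ξ i - (torusSection (toTorus ξ)) i : ℝ) : UnitAddCircle) = 0 := by
      rw [AddCircle.coe_sub, sub_eq_zero]; exact h1.symm
    obtain ⟨j, hj⟩ := (AddCircle.coe_eq_zero_iff 1).1 h2
    exact ⟨j, by simpa using hj.symm⟩
  choose k hk using h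
  refine ⟨k, ?_⟩
  ext i
  simp [torusUnfold, latticePoint, ← hk]

theorem latticePoint_add (k l : Fin n → ℤ) :
    latticePoint (k + l) = latticePoint k + latticePoint l := by
  ext i; simp [latticePoint]

theorem torusUnfold_add (x : UnitAddTorus (Fin n)) (k l : Fin n → ℤ) :
    torusUnfold (x, k) + latticePoint l = torusUnfold (x, k + l) := by
  simp only [torusUnfold, latticePoint_add, add_assoc]

theorem measurePreserving_torusSection :
    MeasurePreserving (torusSection (n := n)) volume (volume.restrict (unitCube n)) := by
  have h1 := UnitAddTorus.measurePreserving_equivPiIoc (d := Fin n) 0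
  have hm : MeasurableSet {x : Fin n → ℝ | ∀ i, x i ∈ Set.Ioc ((0 : Fin n → ℝ) i)
      ((0 : Fin n → ℝ) i + 1)} := MeasurableSet.univ_pi' fun i => measurableSet_Ioc
  have h2 := (measurePreserving_subtype_coe (μa := volume) hm).comp h1
  have h3 := (PiLp.volume_preserving_toLp (Fin n)).restrict_preimage
    (measurableSet_cube (n := n) 0 1)
  have h4 : (WithLp.toLp 2 : (Fin n → ℝ) → RSpace n) ⁻¹' {ξ | ∀ i, ξ i ∈ Set.Ioc (0 : ℝ) 1} =
      {x : Fin n → ℝ | ∀ i, x i ∈ Set.Ioc ((0 : Fin n → ℝ) i) ((0 : Fin n → ℝ) i + 1)} := by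
    ext; simp
  rw [h4] at h3
  have h5 : MeasurePreserving
      (fun x : UnitAddTorus (Fin n) => (torusSection x).ofLp) volume
      (volume.restrict {x : Fin n → ℝ | ∀ i, x i ∈ Set.Ioc ((0 : Fin n → ℝ) i)
        ((0 : Fin n → ℝ) i + 1)}) := h2
  exact h3.comp h5

theorem measurable_torusUnfold : Measurable (torusUnfold (n := n)) :=
  (measurePreserving_torusSection.measurable.comp measurable_fst).add
    ((measurable_of_countable latticePoint).comp measurable_snd)

/-- Integration over `ℝⁿ` is integration over the torus of the sum over `ℤⁿ`. -/
theorem measurePreserving_torusUnfold :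
    MeasurePreserving (torusUnfold (n := n)) (volume.prod Measure.count) volume := by
  refine ⟨measurable_torusUnfold, Measure.ext fun A hA => ?_⟩
  rw [Measure.map_apply measurable_torusUnfold hA,
    Measure.prod_apply_symm (measurable_torusUnfold hA), lintegral_count]
  let C : (Fin n → ℤ) → Set (RSpace n) := fun k => {ξ | ξ - latticePoint k ∈ unitCube n}
  have hC : ∀ k, MeasurableSet (C k) := fun k =>
    (measurable_id.sub_const (latticePoint k)) (measurableSet_cube 0 1)
  have hterm : ∀ k, volume ((fun x => (x, k)) ⁻¹' (torusUnfold ⁻¹' A)) =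
      volume (A ∩ C k) := fun k => by
    have hA' : MeasurableSet ((fun ξ : RSpace n => ξ + latticePoint k) ⁻¹' A) :=
      (measurable_id.add_const (latticePoint k)) hA
    have h1 := measurePreserving_torusSection.measure_preimage hA'.nullMeasurableSet
    rw [Measure.restrict_apply hA'] at h1
    rw [← measure_preimage_add_right volume (latticePoint k) (A ∩ C k)]
    refine Eq.trans ?_ (h1.trans ?_)
    · rfl
    · congr 1
      ext ξ
      simp [C]
  simp_rw [hterm]
  rw [← measure_iUnion]
  · rw [← Set.inter_iUnion]
    congr 1
    rw [Set.inter_eq_left]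
    intro ξ _
    obtain ⟨k, hk⟩ := exists_torusUnfold_eq ξ
    refine Set.mem_iUnion.2 ⟨k, ?_⟩
    show ξ - latticePoint k ∈ unitCube n
    have h : ξ - latticePoint k = torusSection (toTorus ξ) := sub_eq_of_eq_add hk.symm
    rw [h]
    intro i
    have hi := (AddCircle.equivIoc (1 : ℝ) 0 (toTorus ξ i)).2
    exact ⟨hi.1, hi.2.trans (zero_add (1 : ℝ)).le⟩
  · intro k l hkl
    refine Set.disjoint_left.2 fun ξ h1 h2 => hkl (funext fun i => ?_)
    have h3 := h1.2 i
    have h4 := h2.2 i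
    simp only [latticePoint, PiLp.sub_apply, Set.mem_Ioc] at h3 h4
    have h5 : (k i : ℝ) - l i < 1 := by linarith
    have h6 : (l i : ℝ) - k i < 1 := by linarith
    have h7 : k i - l i < 1 := by exact_mod_cast h5
    have h8 : l i - k i < 1 := by exact_mod_cast h6
    omega
  · exact fun k => hA.inter (hC k)

theorem measurePreserving_toTorus_restrict (a : ℝ) :
    MeasurePreserving (toTorus (n := n))
      (volume.restrict {ξ : RSpace n | ∀ i, ξ i ∈ Set.Icc a (a + 1)}) volume := by
  have hm : MeasurableSet (Set.univ.pi fun _ : Fin n => Set.Icc a (a + 1)) :=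
    MeasurableSet.univ_pi fun _ => measurableSet_Icc
  have h1 := (PiLp.volume_preserving_ofLp (Fin n)).restrict_preimage hm
  have h2 : (WithLp.ofLp : RSpace n → Fin n → ℝ) ⁻¹' (Set.univ.pi fun _ => Set.Icc a (a + 1)) =
      {ξ : RSpace n | ∀ i, ξ i ∈ Set.Icc a (a + 1)} := by
    ext; simp only [Set.mem_preimage, Set.mem_univ_pi]; rfl
  rw [h2, volume_pi, Measure.restrict_pi_pi] at h1
  have h3 : (volume : Measure ℝ).restrict (Set.Icc a (a + 1)) =
      volume.restrict (Set.Ioc a (a + 1)) := Measure.restrict_congr_set Ioc_ae_eq_Icc.symm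
  rw [h3] at h1
  have h4 := measurePreserving_pi (fun _ : Fin n => volume.restrict (Set.Ioc a (a + 1))) _
    fun _ => UnitAddCircle.measurePreserving_mk a
  rw [← volume_unitAddCircle_eq] at h4
  exact h4.comp h1

/-- Up to the factor `|s|ⁿ`, the map `ω ↦ ω / s` carries Lebesgue measure on `[0, |s|]ⁿ` to Haar
measure of the torus, for both signs of `s`. -/
theorem measurePreserving_toTorus_thetaCube {θ : ℝ} (hθ : Real.sin θ ≠ 0) :
    MeasurePreserving (fun ω : RSpace n => toTorus ((Real.sin θ)⁻¹ • ω))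
      (volume.restrict (thetaCube n θ)) (ENNReal.ofReal (|Real.sin θ| ^ n) • volume) := by
  set s := Real.sin θ
  -- Division by `s` carries `[0, |s|]` to `[0, 1]` or to `[-1, 0]`.
  obtain ⟨a, ha⟩ : ∃ a : ℝ, ∀ y : ℝ, y ∈ Set.Icc 0 |s| ↔ s⁻¹ * y ∈ Set.Icc a (a + 1) := by
    rcases lt_or_gt_of_ne hθ with h | h
    · refine ⟨-1, fun y => ?_⟩
      rw [abs_of_neg h, Set.mem_Icc, Set.mem_Icc, inv_mul_eq_div, le_div_iff_of_neg h,
        div_le_iff_of_neg h]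
      constructor <;> rintro ⟨h1, h2⟩ <;> constructor <;> linarith
    · refine ⟨0, fun y => ?_⟩
      rw [abs_of_pos h, Set.mem_Icc, Set.mem_Icc, inv_mul_eq_div, le_div_iff₀ h, div_le_iff₀ h]
      constructor <;> rintro ⟨h1, h2⟩ <;> constructor <;> linarith
  have hscale : MeasurePreserving (fun ω : RSpace n => s⁻¹ • ω) volume
      (ENNReal.ofReal (|s| ^ n) • volume) := by
    refine ⟨measurable_const_smul _, ?_⟩
    rw [Measure.map_addHaar_smul _ (inv_ne_zero hθ)]
    simp [abs_pow]
  have hm : MeasurableSet {ξ : RSpace n | ∀ i, ξ i ∈ Set.Icc a (a + 1)} := by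
    have : {ξ : RSpace n | ∀ i, ξ i ∈ Set.Icc a (a + 1)} =
        (WithLp.ofLp : RSpace n → Fin n → ℝ) ⁻¹' Set.univ.pi fun _ => Set.Icc a (a + 1) := by
      ext; simp only [Set.mem_preimage, Set.mem_univ_pi]; rfl
    rw [this]
    exact WithLp.measurable_ofLp 2 _ (MeasurableSet.univ_pi fun _ => measurableSet_Icc)
  have h1 := hscale.restrict_preimage hm
  have h2 : (fun ω : RSpace n => s⁻¹ • ω) ⁻¹' {ξ : RSpace n | ∀ i, ξ i ∈ Set.Icc a (a + 1)} =
      thetaCube n θ := by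
    ext ω
    exact forall_congr' fun i => (ha (ω i)).symm
  rw [h2, Measure.restrict_smul] at h1
  exact ((measurePreserving_toTorus_restrict a).smul_measure _).comp h1

end Periodization

/-! ### Fibers of square integrable functions over the torus -/

section Fibers

variable {n : ℕ}

theorem ae_torusUnfold {P : RSpace n → Prop} (h : ∀ᵐ ξ, P ξ) :
    ∀ᵐ x : UnitAddTorus (Fin n), ∀ k, P (torusUnfold (x, k)) := by
  have h1 := measurePreserving_torusUnfold.quasiMeasurePreserving.ae h
  filter_upwards [Measure.ae_ae_of_ae_prod h1] with x hx
  exact Measure.ae_count_iff.1 hx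

theorem lintegral_torusUnfold {g : RSpace n → ENNReal} (hg : AEMeasurable g) :
    ∫⁻ x : UnitAddTorus (Fin n), ∑' k, g (torusUnfold (x, k)) = ∫⁻ ξ, g ξ := by
  have h := measurePreserving_torusUnfold (n := n)
  rw [← h.map_eq] at hg ⊢
  rw [lintegral_map' hg measurable_torusUnfold.aemeasurable,
    lintegral_prod (fun p => g (torusUnfold p)) (hg.comp_measurable measurable_torusUnfold)]
  simp_rw [lintegral_count]

theorem memℓp_two_iff {ι : Type*} (f : ι → ℂ) :
    Memℓp f 2 ↔ ∑' k, ‖f k‖ₑ ^ 2 ≠ ⊤ := by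
  rw [memℓp_gen_iff (by norm_num)]
  have h : ∀ k, ‖f k‖ₑ ^ 2 = ENNReal.ofReal (‖f k‖ ^ 2) := fun k => by
    rw [ENNReal.ofReal_pow (norm_nonneg _), ofReal_norm]
  simp_rw [h]
  constructor
  · intro hs
    exact (ENNReal.ofReal_tsum_of_nonneg (fun k => sq_nonneg _) (by simpa using hs)) ▸
      ENNReal.ofReal_ne_top
  · intro hs
    have := ENNReal.summable_toReal hs
    simpa [ENNReal.toReal_ofReal] using this

theorem enorm_sq_lp {ι : Type*} (f : lp (fun _ : ι => ℂ) 2) :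
    ‖f‖ₑ ^ 2 = ∑' k, ‖f k‖ₑ ^ 2 := by
  have h : ∀ k, ‖f k‖ₑ ^ 2 = ENNReal.ofReal (‖f k‖ ^ 2) := fun k => by
    rw [ENNReal.ofReal_pow (norm_nonneg _), ofReal_norm]
  have h1 := lp.norm_rpow_eq_tsum (p := 2) (by norm_num) f
  have h2 := (lp.memℓp f).summable (by norm_num)
  simp only [ENNReal.toReal_ofNat, Real.rpow_ofNat] at h1 h2
  simp_rw [h]
  rw [← ENNReal.ofReal_tsum_of_nonneg (fun k => sq_nonneg _) h2, ← h1,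
    ENNReal.ofReal_pow (norm_nonneg _), ofReal_norm]

open Classical in
/-- The fiber of `F ∈ L²(ℝⁿ)` at a point `x` of the torus: the restriction of `F` to the coset of
`ℤⁿ` determined by `x`, as an element of `ℓ²(ℤⁿ)`. On the null set of `x` where it is not square
summable, the fiber is `0`. -/
def fiber (F : L2Space n) (x : UnitAddTorus (Fin n)) : lp (fun _ : Fin n → ℤ => ℂ) 2 :=
  if h : Memℓp (fun k => F (torusUnfold (x, k))) 2 then ⟨_, h⟩ else 0

theorem ae_memℓp_fiber (F : L2Space n) :
    ∀ᵐ x : UnitAddTorus (Fin n), Memℓp (fun k => F (torusUnfold (x, k))) 2 := by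
  have hm : AEMeasurable (fun ξ => ‖F ξ‖ₑ ^ 2) volume :=
    ((Lp.aestronglyMeasurable F).enorm.pow_const 2)
  have hfin : ∫⁻ ξ, ‖F ξ‖ₑ ^ 2 ≠ ⊤ := by
    have h := (Lp.memLp F).eLpNorm_lt_top
    rw [eLpNorm_lt_top_iff_lintegral_rpow_enorm_lt_top (by norm_num) (by norm_num)] at h
    simpa using h.ne
  rw [← lintegral_torusUnfold hm] at hfin
  have hm' : AEMeasurable (fun x : UnitAddTorus (Fin n) =>
      ∑' k : Fin n → ℤ, ‖F (torusUnfold (x, k))‖ₑ ^ 2) volume := by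
    refine AEMeasurable.tsum fun k => Measurable.aemeasurable ?_
    exact (((Lp.stronglyMeasurable F).measurable.comp
      (measurable_torusUnfold.comp measurable_prodMk_right)).enorm.pow_const 2)
  filter_upwards [ae_lt_top' hm' hfin] with x hx
  exact (memℓp_two_iff _).2 hx.ne

theorem ae_fiber_apply (F : L2Space n) :
    ∀ᵐ x : UnitAddTorus (Fin n), ∀ k, fiber F x k = F (torusUnfold (x, k)) := by
  filter_upwards [ae_memℓp_fiber F] with x hx k
  rw [fiber, dif_pos hx]

/-- The fiber map turns multiplication by periodic functions into multiplication by scalars. -/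
theorem ae_fiber_eq_sum {ι : Type*} [Fintype ι] {F : L2Space n} {G : ι → L2Space n}
    {c : ι → UnitAddTorus (Fin n) → ℂ}
    (h : ∀ᵐ ξ, F ξ = ∑ j, c j (toTorus ξ) * G j ξ) :
    ∀ᵐ x, fiber F x = ∑ j, c j x • fiber (G j) x := by
  have hG : ∀ᵐ x : UnitAddTorus (Fin n), ∀ j, ∀ k, fiber (G j) x k = G j (torusUnfold (x, k)) :=
    ae_all_iff.2 fun j => ae_fiber_apply (G j)
  filter_upwards [ae_torusUnfold h, ae_fiber_apply F, hG] with x hx hF hG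
  ext k
  rw [hF, hx, toTorus_torusUnfold, lp.coeFn_sum, Finset.sum_apply]
  refine Finset.sum_congr rfl fun j _ => ?_
  rw [lp.coeFn_smul, Pi.smul_apply, hG, smul_eq_mul]

theorem ae_fiber_eq_smul {F G : L2Space n} {c : UnitAddTorus (Fin n) → ℂ}
    (h : ∀ᵐ ξ, F ξ = c (toTorus ξ) * G ξ) : ∀ᵐ x, fiber F x = c x • fiber G x := by
  simpa using ae_fiber_eq_sum (ι := Unit) (F := F) (G := fun _ => G) (c := fun _ => c)
    (by simpa using h)

theorem ae_fiber_add (F G : L2Space n) : ∀ᵐ x, fiber (F + G) x = fiber F x + fiber G x := by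
  have := ae_fiber_eq_sum (ι := Fin 2) (F := F + G) (G := ![F, G]) (c := fun _ _ => 1) (by
    filter_upwards [Lp.coeFn_add F G] with ξ h
    rw [h]; simp)
  simpa using this

theorem ae_fiber_smul (c : ℂ) (F : L2Space n) : ∀ᵐ x, fiber (c • F) x = c • fiber F x := by
  refine ae_fiber_eq_smul (c := fun _ => c) ?_
  filter_upwards [Lp.coeFn_smul c F] with ξ h
  simp [h]

theorem ae_fiber_sub (F G : L2Space n) : ∀ᵐ x, fiber (F - G) x = fiber F x - fiber G x := by
  filter_upwards [ae_fiber_add F ((-1 : ℂ) • G), ae_fiber_smul (-1) G] with x h1 h2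
  rw [show F - G = F + (-1 : ℂ) • G by rw [neg_one_smul, sub_eq_add_neg], h1, h2]
  rw [neg_one_smul, sub_eq_add_neg]

theorem integral_inner_fiber (F G : L2Space n) :
    Integrable (fun x => inner ℂ (fiber F x) (fiber G x)) ∧
      ∫ x, inner ℂ (fiber F x) (fiber G x) = inner ℂ F G := by
  have h1 : Integrable (fun p : UnitAddTorus (Fin n) × (Fin n → ℤ) =>
      inner ℂ (F (torusUnfold p)) (G (torusUnfold p))) (volume.prod Measure.count) :=
    measurePreserving_torusUnfold.integrable_comp_of_integrable (L2.integrable_inner (𝕜 := ℂ) F G)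
  have h2 : (fun x : UnitAddTorus (Fin n) =>
      ∫ k, inner ℂ (F (torusUnfold (x, k))) (G (torusUnfold (x, k))) ∂Measure.count)
      =ᵐ[volume] fun x => inner ℂ (fiber F x) (fiber G x) := by
    filter_upwards [ae_fiber_apply F, ae_fiber_apply G, h1.prod_right_ae] with x hF hG hi
    rw [integral_countable hi, lp.inner_eq_tsum]
    simp [hF, hG]
  refine ⟨h1.integral_prod_left.congr h2, ?_⟩
  rw [← integral_congr_ae h2, ← integral_prod _ h1, L2.inner_def]
  have h3 : ∀ g : RSpace n → ℂ, AEStronglyMeasurable g volume →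
      ∫ p, g (torusUnfold p) ∂(volume.prod Measure.count) = ∫ ξ, g ξ := fun g hg => by
    have h := measurePreserving_torusUnfold (n := n)
    rw [← h.map_eq] at hg ⊢
    exact (integral_map h.measurable.aemeasurable hg).symm
  exact h3 _ (L2.integrable_inner (𝕜 := ℂ) F G).aestronglyMeasurable

theorem integral_norm_sq_fiber (F : L2Space n) :
    Integrable (fun x => ‖fiber F x‖ ^ 2) ∧ ∫ x, ‖fiber F x‖ ^ 2 = ‖F‖ ^ 2 := by
  obtain ⟨h1, h2⟩ := integral_inner_fiber F F
  have h3 : (fun x => RCLike.re (inner ℂ (fiber F x) (fiber F x))) = fun x => ‖fiber F x‖ ^ 2 := by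
    ext x; exact inner_self_eq_norm_sq _
  refine ⟨h3 ▸ h1.re, ?_⟩
  rw [← h3, ← inner_self_eq_norm_sq (𝕜 := ℂ) F, ← h2]
  exact integral_re h1

/-- A combination of fibers with measurable coefficients is the fiber of an element of `L²(ℝⁿ)` as
soon as it is bounded, since the torus has finite measure. -/
theorem exists_fiber_eq_sum {ι : Type*} [Fintype ι] (G : ι → L2Space n)
    {c : ι → UnitAddTorus (Fin n) → ℂ} (hc : ∀ j, AEMeasurable (c j)) {C : NNReal}
    (hC : ∀ᵐ x, ‖∑ j, c j x • fiber (G j) x‖ₑ ≤ C) :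
    ∃ F : L2Space n, ∀ᵐ x, fiber F x = ∑ j, c j x • fiber (G j) x := by
  set d := fun j => (hc j).mk (c j)
  have hd : ∀ᵐ x, ∀ j, c j x = d j x := ae_all_iff.2 fun j => (hc j).ae_eq_mk
  let g : RSpace n → ℂ := fun ξ => ∑ j, d j (toTorus ξ) * G j ξ
  have hg : Measurable g := by
    refine Finset.measurable_sum _ fun j _ => ?_
    exact (((hc j).measurable_mk).comp measurable_toTorus).mul
      (Lp.stronglyMeasurable (G j)).measurable
  have hmem : MemLp g 2 volume := by
    refine ⟨hg.aestronglyMeasurable, ?_⟩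
    rw [eLpNorm_lt_top_iff_lintegral_rpow_enorm_lt_top (by norm_num) (by norm_num)]
    simp only [ENNReal.toReal_ofNat, ENNReal.rpow_ofNat]
    rw [← lintegral_torusUnfold (hg.enorm.pow_const 2).aemeasurable]
    have hG : ∀ᵐ x : UnitAddTorus (Fin n), ∀ j, ∀ k,
        fiber (G j) x k = G j (torusUnfold (x, k)) := ae_all_iff.2 fun j => ae_fiber_apply (G j)
    have hle : ∀ᵐ x : UnitAddTorus (Fin n),
        ∑' k : Fin n → ℤ, ‖g (torusUnfold (x, k))‖ₑ ^ 2 ≤ (C : ENNReal) ^ 2 := by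
      filter_upwards [hd, hG, hC] with x hd hG hC
      refine le_trans (le_of_eq ?_) (pow_le_pow_left' hC 2)
      rw [enorm_sq_lp]
      refine tsum_congr fun k => ?_
      simp only [g, toTorus_torusUnfold]
      rw [lp.coeFn_sum, Finset.sum_apply]
      simp [hd, hG]
    refine (lintegral_mono_ae hle).trans_lt ?_
    rw [lintegral_const]
    exact ENNReal.mul_lt_top (by finiteness) (measure_lt_top _ _)
  refine ⟨hmem.toLp, ?_⟩
  have := ae_fiber_eq_sum (F := hmem.toLp) (G := G) (c := d) hmem.coeFn_toLp
  filter_upwards [this, hd] with x h1 h2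
  simp_rw [h1, h2]

end Fibers

/-! ### The chirped Fourier transform of a θ-translate -/

section ChirpFourier

variable {n : ℕ}

theorem ae_chirp (θ : ℝ) (f : L2Space n) : chirp θ f =ᵐ[volume] chirpFun θ f :=
  MemLp.coeFn_toLp _

theorem chirp_chirp_neg (θ : ℝ) (f : L2Space n) : chirp θ (chirp (-θ) f) = f := by
  refine Lp.ext ?_
  filter_upwards [ae_chirp θ (chirp (-θ) f), ae_chirp (-θ) f] with t h1 h2
  rw [h1, chirpFun, h2, chirpFun, ← mul_assoc, ← Complex.exp_add, ← add_mul, ← Complex.ofReal_add]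
  have : Real.cot (-θ) = -Real.cot θ := by
    rw [Real.cot_eq_cos_div_sin, Real.cot_eq_cos_div_sin, Real.cos_neg, Real.sin_neg, div_neg]
  rw [this]
  simp

/-- The chirp modulation as a linear isometric isomorphism. -/
def chirpLinearIsometryEquiv (n : ℕ) (θ : ℝ) : L2Space n ≃ₗᵢ[ℂ] L2Space n where
  toFun := chirp θ
  invFun := chirp (-θ)
  left_inv f := by simpa using chirp_chirp_neg (-θ) f
  right_inv f := chirp_chirp_neg θ f
  map_add' f g := by
    refine Lp.ext ?_
    filter_upwards [ae_chirp θ (f + g), Lp.coeFn_add (chirp θ f) (chirp θ g), ae_chirp θ f,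
      ae_chirp θ g, Lp.coeFn_add f g] with t h1 h2 h3 h4 h5
    rw [h1, h2, Pi.add_apply, h3, h4, chirpFun, chirpFun, chirpFun, h5, Pi.add_apply, mul_add]
  map_smul' c f := by
    refine Lp.ext ?_
    filter_upwards [ae_chirp θ (c • f), Lp.coeFn_smul c (chirp θ f), ae_chirp θ f,
      Lp.coeFn_smul c f] with t h1 h2 h3 h4
    rw [h1, RingHom.id_apply, h2, Pi.smul_apply, h3, chirpFun, chirpFun, h4, Pi.smul_apply,
      smul_eq_mul, smul_eq_mul, mul_left_comm]
  norm_map' f := by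
    refine (Lp.norm_le_norm_of_ae_le ?_).antisymm (Lp.norm_le_norm_of_ae_le ?_) <;>
    · filter_upwards [ae_chirp θ f] with t h
      simp only [LinearEquiv.coe_mk, LinearMap.coe_mk, AddHom.coe_mk]
      rw [h, chirpFun, norm_mul, Complex.norm_exp_ofReal_mul_I, one_mul]

/-- The unitary operator `f ↦ (C_θ f)^`, under which `θ`-translations become, up to unimodular
constants, multiplications by characters. -/
def chirpFourier (n : ℕ) (θ : ℝ) : L2Space n ≃ₗᵢ[ℂ] L2Space n :=
  (chirpLinearIsometryEquiv n θ).trans (Lp.fourierTransformₗᵢ (RSpace n) ℂ)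

theorem chirpFourier_apply (θ : ℝ) (f : L2Space n) :
    chirpFourier n θ f = (𝓕 (chirp θ f) : L2Space n) := rfl

/-- Translation by `s` on `L²(ℝⁿ)`. -/
def l2Translate (s : RSpace n) : L2Space n →ₗᵢ[ℂ] L2Space n :=
  Lp.compMeasurePreservingₗᵢ ℂ (fun t => t - s) (measurePreserving_sub_right volume s)

theorem ae_translate (s : RSpace n) (f : L2Space n) :
    l2Translate s f =ᵐ[volume] fun t => f (t - s) :=
  Lp.coeFn_compMeasurePreserving f (measurePreserving_sub_right volume s)

theorem memLp_modulateFun (s : RSpace n) (f : L2Space n) :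
    MemLp (fun ξ => Complex.exp (((-2 * Real.pi * inner ℝ s ξ : ℝ) : ℂ) * Complex.I) * f ξ) 2
      volume :=
  memLp_phase_mul (p := fun ξ => -2 * Real.pi * inner ℝ s ξ) (by fun_prop) (Lp.memLp f)

/-- Multiplication by the character `ξ ↦ exp(-2πi ⟨s, ξ⟩)` on `L²(ℝⁿ)`. -/
def l2Modulate (s : RSpace n) (f : L2Space n) : L2Space n := (memLp_modulateFun s f).toLp

theorem continuous_modulate (s : RSpace n) : Continuous (l2Modulate (n := n) s) := by
  refine (LipschitzWith.of_dist_le_mul (K := 1) fun f g => ?_).continuous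
  rw [NNReal.coe_one, one_mul, dist_eq_norm, dist_eq_norm]
  refine Lp.norm_le_norm_of_ae_le ?_
  filter_upwards [Lp.coeFn_sub (l2Modulate s f) (l2Modulate s g), Lp.coeFn_sub f g,
    (memLp_modulateFun s f).coeFn_toLp, (memLp_modulateFun s g).coeFn_toLp] with ξ h1 h2 h3 h4
  rw [h1, h2, Pi.sub_apply, Pi.sub_apply, l2Modulate, l2Modulate, h3, h4, ← mul_sub, norm_mul,
    Complex.norm_exp_ofReal_mul_I, one_mul]

/-- The Fourier transform on `L²(ℝⁿ)` turns translations into modulations. -/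
theorem fourier_translate (s : RSpace n) (f : L2Space n) :
    (𝓕 (l2Translate s f) : L2Space n) = l2Modulate s (𝓕 f : L2Space n) := by
  refine DenseRange.induction_on (p := fun f : L2Space n =>
    (𝓕 (l2Translate s f) : L2Space n) = l2Modulate s (𝓕 f : L2Space n))
    (SchwartzMap.denseRange_toLpCLM (E := RSpace n) (F := ℂ)  (μ := volume) (p := 2)
      ENNReal.ofNat_ne_top) f ?_ fun g => ?_
  · exact isClosed_eq
      ((Lp.fourierTransformₗᵢ (RSpace n) ℂ).continuous.comp (l2Translate s).continuous)
      ((continuous_modulate s).comp (Lp.fourierTransformₗᵢ (RSpace n) ℂ).continuous)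
  · have hg : SchwartzMap.toLpCLM ℝ ℂ 2 (volume : Measure (RSpace n)) g = g.toLp 2 := rfl
    have h1 : l2Translate s (g.toLp 2) = (SchwartzMap.compSubConstCLM ℂ s g).toLp 2 := by
      refine Lp.ext ?_
      filter_upwards [ae_translate s (g.toLp 2),
        (SchwartzMap.compSubConstCLM ℂ s g).coeFn_toLp 2 volume,
        (measurePreserving_sub_right volume s).quasiMeasurePreserving.ae (g.coeFn_toLp 2 volume)]
        with t h1 h2 h3
      rw [h1, h2, h3, SchwartzMap.compSubConstCLM_apply]
    rw [hg, h1, SchwartzMap.toLp_fourier_eq, SchwartzMap.toLp_fourier_eq]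
    refine Lp.ext ?_
    filter_upwards [(memLp_modulateFun s ((𝓕 g).toLp 2)).coeFn_toLp, (𝓕 g).coeFn_toLp 2 volume,
      (𝓕 (SchwartzMap.compSubConstCLM ℂ s g)).coeFn_toLp 2 volume] with ξ h1 h2 h3
    rw [l2Modulate, h1, h2, h3, SchwartzMap.fourier_coe, SchwartzMap.fourier_coe]
    have h4 := congrFun (VectorFourier.fourierIntegral_comp_add_right Real.fourierChar volume
      (innerₗ (RSpace n)) g (-s)) ξ
    have h5 : (⇑(SchwartzMap.compSubConstCLM ℂ s g) : RSpace n → ℂ) = g ∘ fun v => v + -s := by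
      ext v; simp [sub_eq_add_neg]
    rw [h5]
    refine h4.trans ?_
    rw [Circle.smul_def, smul_eq_mul, Real.fourierChar_apply]
    congr 2
    simp

theorem mFourier_toTorus (k : Fin n → ℤ) (ξ : RSpace n) :
    UnitAddTorus.mFourier (-k) (toTorus ξ) =
      Complex.exp (((-2 * Real.pi * inner ℝ (latticePoint k) ξ : ℝ) : ℂ) * Complex.I) := by
  simp only [UnitAddTorus.mFourier, ContinuousMap.coe_mk, toTorus, fourier_coe_apply, Pi.neg_apply]
  rw [← Complex.exp_sum]
  congr 1
  simp only [PiLp.inner_apply, latticePoint]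
  push_cast
  simp only [Finset.mul_sum, Finset.sum_mul, RCLike.inner_apply]
  refine Finset.sum_congr rfl fun i _ => ?_
  simp
  ring

/-- Completing the square `|t|² = |t - s|² + 2⟨s, t - s⟩ + |s|²` absorbs the phase of the
`θ`-translation. -/
theorem chirp_thetaTranslate (θ : ℝ) (s : RSpace n) (f : L2Space n) :
    chirp θ (thetaTranslate θ s f) =
      Complex.exp (((Real.pi * ‖s‖ ^ 2 * Real.cot θ : ℝ) : ℂ) * Complex.I) •
        l2Translate s (chirp θ f) := by
  refine Lp.ext ?_
  filter_upwards [ae_chirp θ (thetaTranslate θ s f), (memLp_thetaTranslateFun θ s f).coeFn_toLp,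
    Lp.coeFn_smul (Complex.exp (((Real.pi * ‖s‖ ^ 2 * Real.cot θ : ℝ) : ℂ) * Complex.I))
      (l2Translate s (chirp θ f)), ae_translate s (chirp θ f),
    (measurePreserving_sub_right volume s).quasiMeasurePreserving.ae (ae_chirp θ f)]
    with t h1 h2 h3 h4 h5
  rw [h1, h3, Pi.smul_apply, h4, h5, chirpFun, thetaTranslate, h2, thetaTranslateFun, chirpFun,
    smul_eq_mul, ← mul_assoc, ← mul_assoc, ← Complex.exp_add, ← Complex.exp_add, ← add_mul,
    ← add_mul, ← Complex.ofReal_add, ← Complex.ofReal_add]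
  have h : ‖t‖ ^ 2 = ‖t - s‖ ^ 2 + 2 * inner ℝ s (t - s) + ‖s‖ ^ 2 := by
    have := norm_add_sq_real s (t - s)
    rw [add_sub_cancel] at this
    linarith
  rw [h]
  congr 4
  ring

theorem ae_fiber_chirpFourier_thetaTranslate (θ : ℝ) (k : Fin n → ℤ) :
    ∃ c : ℂ, ‖c‖ = 1 ∧ ∀ f : L2Space n, ∀ᵐ x,
      fiber (chirpFourier n θ (thetaTranslate θ (latticePoint k) f)) x =
        (c * UnitAddTorus.mFourier (-k) x) • fiber (chirpFourier n θ f) x := by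
  refine ⟨Complex.exp (((Real.pi * ‖latticePoint k‖ ^ 2 * Real.cot θ : ℝ) : ℂ) * Complex.I),
    Complex.norm_exp_ofReal_mul_I _, fun f => ae_fiber_eq_smul ?_⟩
  have h : chirpFourier n θ (thetaTranslate θ (latticePoint k) f) =
      Complex.exp (((Real.pi * ‖latticePoint k‖ ^ 2 * Real.cot θ : ℝ) : ℂ) * Complex.I) •
        l2Modulate (latticePoint k) (chirpFourier n θ f) := by
    rw [chirpFourier_apply, chirp_thetaTranslate, FourierTransform.fourier_smul, fourier_translate]
    rfl
  rw [h]
  filter_upwards [Lp.coeFn_smul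
    (Complex.exp (((Real.pi * ‖latticePoint k‖ ^ 2 * Real.cot θ : ℝ) : ℂ) * Complex.I))
    (l2Modulate (latticePoint k) (chirpFourier n θ f)),
    (memLp_modulateFun (latticePoint k) (chirpFourier n θ f)).coeFn_toLp] with ξ h1 h2
  rw [h1, Pi.smul_apply, l2Modulate, h2, mFourier_toTorus, smul_eq_mul]
  ring

end ChirpFourier

/-! ### Parseval frames of θ-shifts -/

section ThetaFibers

variable {n : ℕ}

/-- The fiber of `(C_θ f)^` over a point of the torus. -/
def torusFiber (θ : ℝ) (f : L2Space n) (x : UnitAddTorus (Fin n)) :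
    lp (fun _ : Fin n → ℤ => ℂ) 2 :=
  fiber (chirpFourier n θ f) x

theorem ae_torusFiber_add (θ : ℝ) (f g : L2Space n) :
    ∀ᵐ x, torusFiber θ (f + g) x = torusFiber θ f x + torusFiber θ g x := by
  simp only [torusFiber, map_add]; exact ae_fiber_add _ _

theorem ae_torusFiber_sub (θ : ℝ) (f g : L2Space n) :
    ∀ᵐ x, torusFiber θ (f - g) x = torusFiber θ f x - torusFiber θ g x := by
  simp only [torusFiber, map_sub]; exact ae_fiber_sub _ _

theorem ae_torusFiber_smul (θ : ℝ) (c : ℂ) (f : L2Space n) :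
    ∀ᵐ x, torusFiber θ (c • f) x = c • torusFiber θ f x := by
  simp only [torusFiber, map_smul]; exact ae_fiber_smul _ _

theorem ae_torusFiber_zero (θ : ℝ) : ∀ᵐ x, torusFiber (n := n) θ 0 x = 0 := by
  simpa using ae_torusFiber_smul (n := n) θ 0 0

theorem integrable_inner_torusFiber (θ : ℝ) (f g : L2Space n) :
    Integrable fun x => inner ℂ (torusFiber θ f x) (torusFiber θ g x) :=
  (integral_inner_fiber _ _).1

theorem integral_inner_torusFiber (θ : ℝ) (f g : L2Space n) :
    ∫ x, inner ℂ (torusFiber θ f x) (torusFiber θ g x) = inner ℂ f g :=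
  (integral_inner_fiber _ _).2.trans ((chirpFourier n θ).inner_map_map f g)

theorem integrable_norm_sq_torusFiber (θ : ℝ) (f : L2Space n) :
    Integrable fun x => ‖torusFiber θ f x‖ ^ 2 :=
  (integral_norm_sq_fiber _).1

theorem integral_norm_sq_torusFiber (θ : ℝ) (f : L2Space n) :
    ∫ x, ‖torusFiber θ f x‖ ^ 2 = ‖f‖ ^ 2 := by
  rw [← (chirpFourier n θ).norm_map f]
  exact (integral_norm_sq_fiber _).2

/-- The fibers of a finite combination of `θ`-shifts of `ψ_1, …, ψ_r` lie in the span of the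
fibers of the `ψ_i`. -/
theorem ae_torusFiber_mem_span {r : ℕ} {θ : ℝ} {ψ : Fin r → L2Space n} {h : L2Space n}
    (hh : h ∈ Submodule.span ℂ (Set.range (thetaShifts θ ψ))) :
    ∀ᵐ x, torusFiber θ h x ∈ Submodule.span ℂ (Set.range fun i => torusFiber θ (ψ i) x) := by
  induction hh using Submodule.span_induction with
  | mem h hh =>
    obtain ⟨⟨i, k⟩, rfl⟩ := hh
    obtain ⟨c, -, hc⟩ := ae_fiber_chirpFourier_thetaTranslate θ k
    filter_upwards [hc (ψ i)] with x hx
    rw [torusFiber, thetaShifts, hx]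
    exact Submodule.smul_mem _ _ (Submodule.subset_span ⟨i, rfl⟩)
  | zero =>
    filter_upwards [ae_torusFiber_zero (n := n) θ] with x hx
    rw [hx]; exact Submodule.zero_mem _
  | add a b _ _ ha hb =>
    filter_upwards [ae_torusFiber_add θ a b, ha, hb] with x hx ha hb
    rw [hx]; exact Submodule.add_mem _ ha hb
  | smul c a _ ha =>
    filter_upwards [ae_torusFiber_smul θ c a, ha] with x hx ha
    rw [hx]; exact Submodule.smul_mem _ _ ha

/-- The inner products with the `θ`-shifts of `φ` are, up to unimodular constants, the Fourier
coefficients of the bracket `x ↦ ⟨τφ(x), τh(x)⟩`. -/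
theorem norm_inner_thetaTranslate (θ : ℝ) (k : Fin n → ℤ) (φ h : L2Space n) :
    ‖inner ℂ (thetaTranslate θ (latticePoint k) φ) h‖ =
      ‖UnitAddTorus.mFourierCoeff
        (fun x => inner ℂ (torusFiber θ φ x) (torusFiber θ h x)) (-k)‖ := by
  obtain ⟨c, hc1, hc⟩ := ae_fiber_chirpFourier_thetaTranslate θ k
  have h1 : inner ℂ (thetaTranslate θ (latticePoint k) φ) h = (starRingEnd ℂ) c *
      UnitAddTorus.mFourierCoeff (fun x => inner ℂ (torusFiber θ φ x) (torusFiber θ h x)) (-k) := by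
    rw [← integral_inner_torusFiber θ, UnitAddTorus.mFourierCoeff, ← integral_const_mul]
    refine integral_congr_ae ?_
    filter_upwards [hc φ] with x hx
    simp only [torusFiber]
    rw [hx, inner_smul_left, map_mul, ← UnitAddTorus.mFourier_neg, smul_eq_mul, mul_assoc]
  rw [h1, norm_mul, RCLike.norm_conj, hc1, one_mul]

theorem memLp_bracket (θ : ℝ) {φ : L2Space n} (hφ : ∀ᵐ x, ‖torusFiber θ φ x‖ ≤ 1) (h : L2Space n) :
    MemLp (fun x => inner ℂ (torusFiber θ φ x) (torusFiber θ h x)) 2 volume := by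
  have hm := (integrable_inner_torusFiber θ φ h).aestronglyMeasurable
  rw [memLp_two_iff_integrable_sq_norm hm]
  refine (integrable_norm_sq_torusFiber θ h).mono' (hm.norm.pow 2) ?_
  filter_upwards [hφ] with x hx
  rw [Real.norm_of_nonneg (sq_nonneg _)]
  refine pow_le_pow_left₀ (norm_nonneg _) ((norm_inner_le_norm _ _).trans ?_) 2
  exact mul_le_of_le_one_left (norm_nonneg _) hx

theorem hasSum_norm_sq_inner_thetaTranslate (θ : ℝ) {φ : L2Space n}
    (hφ : ∀ᵐ x, ‖torusFiber θ φ x‖ ≤ 1) (h : L2Space n) :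
    HasSum (fun k : Fin n → ℤ => ‖inner ℂ (thetaTranslate θ (latticePoint k) φ) h‖ ^ 2)
      (∫ x, ‖inner ℂ (torusFiber θ φ x) (torusFiber θ h x)‖ ^ 2) := by
  have hB := memLp_bracket θ hφ h
  have h1 := UnitAddTorus.hasSum_sq_mFourierCoeff hB.toLp
  have h2 : ∀ k, UnitAddTorus.mFourierCoeff hB.toLp k =
      UnitAddTorus.mFourierCoeff (fun x => inner ℂ (torusFiber θ φ x) (torusFiber θ h x)) k :=
    fun k => integral_congr_ae (by
      filter_upwards [hB.coeFn_toLp] with x hx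
      rw [hx])
  have h3 : ∫ x, ‖(hB.toLp _) x‖ ^ 2 = ∫ x, ‖inner ℂ (torusFiber θ φ x) (torusFiber θ h x)‖ ^ 2 :=
    integral_congr_ae (by
      filter_upwards [hB.coeFn_toLp] with x hx
      rw [hx])
  rw [h3] at h1
  simp_rw [h2] at h1
  simp_rw [norm_inner_thetaTranslate]
  exact (Equiv.neg (Fin n → ℤ)).hasSum_iff.2 h1

variable {ℓ : ℕ} {θ : ℝ} {φ : Fin ℓ → L2Space n}

theorem hasSum_norm_sq_inner_thetaShifts
    (hφ : ∀ᵐ x, OrthonormalOrZero fun i => torusFiber θ (φ i) x) (h : L2Space n) :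
    HasSum (fun p => ‖inner ℂ (thetaShifts θ φ p) h‖ ^ 2)
      (∫ x, ∑ i, ‖inner ℂ (torusFiber θ (φ i) x) (torusFiber θ h x)‖ ^ 2) := by
  have hle : ∀ i, ∀ᵐ x, ‖torusFiber θ (φ i) x‖ ≤ 1 := fun i => by
    filter_upwards [hφ] with x hx
    rcases hx.2 i with h | h <;> simp [h]
  have h1 := fun i => hasSum_norm_sq_inner_thetaTranslate θ (hle i) h
  have hs : Summable fun p => ‖inner ℂ (thetaShifts θ φ p) h‖ ^ 2 :=
    (summable_prod_of_nonneg fun p => sq_nonneg _).2 ⟨fun i => (h1 i).summable, .of_finite⟩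
  rw [integral_finsetSum _ fun i _ => (memLp_bracket θ (hle i) h).integrable_norm_pow (by norm_num)]
  have h2 := hs.hasSum.prod_fiberwise h1
  rw [← h2.unique (hasSum_fintype _)]
  exact hs.hasSum

theorem integrable_sum_norm_sq_inner_torusFiber
    (hφ : ∀ᵐ x, OrthonormalOrZero fun i => torusFiber θ (φ i) x) (h : L2Space n) :
    Integrable fun x => ∑ i, ‖inner ℂ (torusFiber θ (φ i) x) (torusFiber θ h x)‖ ^ 2 := by
  refine integrable_finsetSum _ fun i _ => (memLp_bracket θ ?_ h).integrable_norm_pow (by norm_num)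
  filter_upwards [hφ] with x hx
  rcases hx.2 i with h | h <;> simp [h]

/-- Generators whose fibers are almost everywhere orthonormal or zero generate a Parseval frame:
for `h` in the generated space, `‖h‖² - ∑ |⟨u, h⟩|²` is the integral of the squared distances from
the fibers of `h` to the spans of the fibers of the generators, hence at most `‖h - h'‖²` for each
finite combination `h'` of the frame. -/
theorem isParsevalFrameFor_thetaShifts
    (hφ : ∀ᵐ x, OrthonormalOrZero fun i => torusFiber θ (φ i) x) :
    IsParsevalFrameFor (thetaShifts θ φ) (thetaShiftSpace θ φ) := by
  refine ⟨fun p => Submodule.le_topologicalClosure _ (Submodule.subset_span ⟨p, rfl⟩),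
    fun h hh => ?_⟩
  have hsum := hasSum_norm_sq_inner_thetaShifts hφ h
  have hint := integrable_sum_norm_sq_inner_torusFiber hφ h
  convert hsum using 1
  refine le_antisymm ?_ ?_
  · have key : ∀ h' ∈ Submodule.span ℂ (Set.range (thetaShifts θ φ)),
        ‖h‖ ^ 2 - ∫ x, ∑ i, ‖inner ℂ (torusFiber θ (φ i) x) (torusFiber θ h x)‖ ^ 2 ≤
          ‖h - h'‖ ^ 2 := fun h' hh' => by
      rw [← integral_norm_sq_torusFiber θ h, ← integral_norm_sq_torusFiber θ (h - h'),
        ← integral_sub (integrable_norm_sq_torusFiber θ h) hint]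
      refine integral_mono_ae ((integrable_norm_sq_torusFiber θ h).sub hint)
        (integrable_norm_sq_torusFiber θ _) ?_
      filter_upwards [hφ, ae_torusFiber_mem_span hh', ae_torusFiber_sub θ h h'] with x h1 h2 h3
      rw [h3]
      exact h1.norm_sq_sub_sum_le _ h2
    obtain ⟨u, hu, hlim⟩ := mem_closure_iff_seq_limit.1
      (show h ∈ closure (Submodule.span ℂ (Set.range (thetaShifts θ φ)) : Set (L2Space n)) from hh)
    have h1 : Tendsto (fun N => ‖h - u N‖ ^ 2) atTop (𝓝 (‖h - h‖ ^ 2)) :=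
      ((tendsto_const_nhds.sub hlim).norm.pow 2)
    have h2 := ge_of_tendsto' h1 fun N => key (u N) (hu N)
    rw [sub_self, norm_zero] at h2
    linarith
  · rw [← integral_norm_sq_torusFiber θ h]
    refine integral_mono_ae hint (integrable_norm_sq_torusFiber θ h) ?_
    filter_upwards [hφ] with x hx
    exact hx.sum_le _

/-- By the Parseval identity, the squared norm of the projection of `f` is the sum of the squared
inner products of `f` with the frame. -/
theorem norm_sq_sub_starProjection_thetaShiftSpace
    (hφ : ∀ᵐ x, OrthonormalOrZero fun i => torusFiber θ (φ i) x) (f : L2Space n) :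
    ‖f - (thetaShiftSpace θ φ).starProjection f‖ ^ 2 =
      ‖f‖ ^ 2 - ∫ x, ∑ i, ‖inner ℂ (torusFiber θ (φ i) x) (torusFiber θ f x)‖ ^ 2 := by
  set V := thetaShiftSpace θ φ
  set g := V.starProjection f with hg
  have hframe := isParsevalFrameFor_thetaShifts hφ
  have hgV : g ∈ V := V.starProjection_apply_mem f
  have h1 := hframe.2 g hgV
  have h2 : ∀ p, inner ℂ (thetaShifts θ φ p) g = inner ℂ (thetaShifts θ φ p) f := fun p => by
    have := V.inner_starProjection_left_eq_right (thetaShifts θ φ p) f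
    rw [Submodule.starProjection_eq_self_iff.2 (hframe.1 p)] at this
    exact this.symm
  simp_rw [h2] at h1
  rw [(hasSum_norm_sq_inner_thetaShifts hφ f).unique h1]
  have h3 : inner ℂ g (f - g) = 0 :=
    (V.sub_starProjection_mem_orthogonal f) g hgV
  have h4 := norm_add_sq_eq_norm_sq_add_norm_sq_of_inner_eq_zero (𝕜 := ℂ) g (f - g) h3
  rw [add_sub_cancel] at h4
  nlinarith

end ThetaFibers

/-! ### Optimal generators -/

section GramDiagonalization

variable {n m : ℕ}

/-- The Gram matrix of the fibers of `f_1, …, f_m` over a point of the torus. -/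
def torusGram (θ : ℝ) (f : Fin m → L2Space n) (x : UnitAddTorus (Fin n)) :
    Matrix (Fin m) (Fin m) ℂ :=
  Matrix.gram ℂ fun i => torusFiber θ (f i) x

/-- Decreasing eigenvalues `μ` and orthonormal eigenvectors `y` of the Gram matrices of the fibers
of `f`, depending measurably on the point of the torus. -/
structure IsGramEigensystem (θ : ℝ) (f : Fin m → L2Space n)
    (μ : Fin m → UnitAddTorus (Fin n) → ℝ)
    (y : Fin m → UnitAddTorus (Fin n) → EuclideanSpace ℂ (Fin m)) : Prop where
  aemeasurable_eigenvalue : ∀ k, AEMeasurable (μ k)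
  aemeasurable_eigenvector : ∀ k, AEMeasurable (y k)
  orthonormal : ∀ x, Orthonormal ℂ fun k => y k x
  mulVec_eq : ∀ x k, (torusGram θ f x).mulVec (y k x) = (μ k x : ℂ) • (y k x).ofLp
  antitone : ∀ x, Antitone fun k => μ k x

theorem exists_isGramEigensystem (θ : ℝ) (f : Fin m → L2Space n) :
    ∃ μ y, IsGramEigensystem θ f μ y := by
  obtain ⟨Λ, v, hΛ, hv, h⟩ := exists_measurable_eigenbasis m
  let L : (Fin m → Fin m → ℂ) →ₗ[ℂ] (EuclideanSpace ℂ (Fin m) →L[ℂ] EuclideanSpace ℂ (Fin m)) :=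
    { toFun := fun A => Matrix.toEuclideanCLM (𝕜 := ℂ) (Matrix.of A)
      map_add' := fun A B => map_add (Matrix.toEuclideanCLM (𝕜 := ℂ) (n := Fin m)) _ _
      map_smul' := fun c A => map_smul (Matrix.toEuclideanCLM (𝕜 := ℂ) (n := Fin m)) c _ }
  have hL : Measurable L := L.continuous_of_finiteDimensional.measurable
  let T := fun x => L (torusGram θ f x)
  have hT : AEMeasurable T := by
    refine hL.comp_aemeasurable
      (aemeasurable_pi_lambda _ fun i => aemeasurable_pi_lambda _ fun j => ?_)
    exact (integrable_inner_torusFiber θ (f i) (f j)).aestronglyMeasurable.aemeasurable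
  have hpos : ∀ x, (T x).IsPositive := fun x =>
    (ContinuousLinearMap.isPositive_toLinearMap_iff _).1
      (Matrix.isPositive_toEuclideanLin_iff.2
        (Matrix.posSemidef_gram ℂ fun i => torusFiber θ (f i) x))
  refine ⟨fun k x => Λ k (T x), fun k x => v k (T x), fun k => (hΛ k).comp_aemeasurable hT,
    fun k => (hv k).comp_aemeasurable hT, fun x => (h _ (hpos x)).1, fun x k => ?_,
    fun x => (h _ (hpos x)).2.2⟩
  exact congrArg WithLp.ofLp ((h _ (hpos x)).2.1 k)

variable {θ : ℝ} {f : Fin m → L2Space n} {μ : Fin m → UnitAddTorus (Fin n) → ℝ}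
  {y : Fin m → UnitAddTorus (Fin n) → EuclideanSpace ℂ (Fin m)}

theorem IsGramEigensystem.nonneg (h : IsGramEigensystem θ f μ y) (k : Fin m)
    (x : UnitAddTorus (Fin n)) : 0 ≤ μ k x :=
  gram_eigenvalue_nonneg (h.orthonormal x) (h.mulVec_eq x) k

theorem IsGramEigensystem.sum_eq (h : IsGramEigensystem θ f μ y) (x : UnitAddTorus (Fin n)) :
    ∑ k, μ k x = ∑ i, ‖torusFiber θ (f i) x‖ ^ 2 :=
  sum_gram_eigenvalue (h.orthonormal x) (h.mulVec_eq x)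

theorem IsGramEigensystem.integrable (h : IsGramEigensystem θ f μ y) (k : Fin m) :
    Integrable (μ k) := by
  refine (integrable_finsetSum Finset.univ fun i _ => integrable_norm_sq_torusFiber θ (f i)).mono'
    (h.aemeasurable_eigenvalue k).aestronglyMeasurable (Eventually.of_forall fun x => ?_)
  rw [Real.norm_of_nonneg (h.nonneg k x), ← h.sum_eq x]
  exact Finset.single_le_sum (fun j _ => h.nonneg j x) (Finset.mem_univ k)

/-- Fiberwise Eckart–Young inequality: the lower bound for the approximation error by spaces with
at most `ℓ` generators. -/
theorem IsGramEigensystem.tail_le_approxError (h : IsGramEigensystem θ f μ y) {r ℓ : ℕ}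
    (hr : r ≤ ℓ) (ψ : Fin r → L2Space n) :
    ∑ k ∈ Finset.univ.filter (fun k : Fin m => ℓ ≤ (k : ℕ)), ∫ x, μ k x ≤ approxError θ f ψ := by
  have key : ∀ g : Fin m → L2Space n,
      (∀ i, g i ∈ Submodule.span ℂ (Set.range (thetaShifts θ ψ))) →
      ∑ k ∈ Finset.univ.filter (fun k : Fin m => ℓ ≤ (k : ℕ)), ∫ x, μ k x ≤
        ∑ i, ‖f i - g i‖ ^ 2 := fun g hg => by
    simp_rw [← integral_norm_sq_torusFiber θ]
    rw [← integral_finsetSum _ fun k _ => h.integrable k,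
      ← integral_finsetSum _ fun i _ => integrable_norm_sq_torusFiber θ _]
    refine integral_mono_ae (integrable_finsetSum _ fun k _ => h.integrable k)
      (integrable_finsetSum _ fun i _ => integrable_norm_sq_torusFiber θ _) ?_
    have h1 : ∀ᵐ x, ∀ i, torusFiber θ (g i) x ∈
        Submodule.span ℂ (Set.range fun j => torusFiber θ (ψ j) x) :=
      ae_all_iff.2 fun i => ae_torusFiber_mem_span (hg i)
    have h2 : ∀ᵐ x, ∀ i, torusFiber θ (f i - g i) x = torusFiber θ (f i) x - torusFiber θ (g i) x :=
      ae_all_iff.2 fun i => ae_torusFiber_sub θ _ _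
    filter_upwards [h1, h2] with x h1 h2
    simp_rw [h2]
    have := FiniteDimensional.span_of_finite ℂ (Set.finite_range fun j => torusFiber θ (ψ j) x)
    refine sum_gram_eigenvalue_tail_le (h.orthonormal x) (h.mulVec_eq x) (h.antitone x) _ ?_ h1
    exact (finrank_range_le_card _).trans (by simpa using hr)
  -- The projections are limits of finite combinations of shifts, to which `key` applies.
  have hcl : ∀ i, ∃ u : ℕ → L2Space n,
      (∀ N, u N ∈ Submodule.span ℂ (Set.range (thetaShifts θ ψ))) ∧
        Tendsto u atTop (𝓝 ((thetaShiftSpace θ ψ).starProjection (f i))) := fun i =>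
    mem_closure_iff_seq_limit.1 ((thetaShiftSpace θ ψ).starProjection_apply_mem (f i))
  choose u hu hlim using hcl
  refine ge_of_tendsto' (f := fun N => ∑ i, ‖f i - u i N‖ ^ 2) (x := atTop) ?_
    fun N => key (fun i => u i N) fun i => hu i N
  exact tendsto_finsetSum _ fun i _ => ((tendsto_const_nhds.sub (hlim i)).norm.pow 2)

/-- Generators whose fibers are the normalized principal vectors of the fibers of `f`, for the `ℓ`
largest eigenvalues; generators beyond the `m`-th are `0`. -/
theorem IsGramEigensystem.exists_generators (h : IsGramEigensystem θ f μ y) (ℓ : ℕ) :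
    ∃ φ : Fin ℓ → L2Space n, ∀ i, ∀ᵐ x, torusFiber θ (φ i) x =
      if hi : (i : ℕ) < m then
        principalVector (fun j => torusFiber θ (f j) x) (y ⟨i, hi⟩ x) (μ ⟨i, hi⟩ x)
      else 0 := by
  suffices H : ∀ i : Fin ℓ, ∃ g : L2Space n, ∀ᵐ x, torusFiber θ g x =
      if hi : (i : ℕ) < m then
        principalVector (fun j => torusFiber θ (f j) x) (y ⟨i, hi⟩ x) (μ ⟨i, hi⟩ x)
      else 0 by
    choose φ hφ using H
    exact ⟨φ, hφ⟩
  intro i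
  by_cases hi : (i : ℕ) < m
  · simp only [dif_pos hi]
    set k : Fin m := ⟨i, hi⟩
    let c : Fin m → UnitAddTorus (Fin n) → ℂ := fun j x => (((√(μ k x))⁻¹ : ℝ) : ℂ) * y k x j
    have hsum : ∀ x, ∑ j, c j x • fiber (chirpFourier n θ (f j)) x =
        principalVector (fun j => torusFiber θ (f j) x) (y k x) (μ k x) := fun x => by
      simp only [principalVector, Finset.smul_sum, smul_smul, c]
      rfl
    have hc : ∀ j, AEMeasurable (c j) := fun j => by
      have h1 := (h.aemeasurable_eigenvalue k).sqrt.inv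
      have h2 : AEMeasurable fun x => y k x j :=
        (EuclideanSpace.proj (𝕜 := ℂ) j).continuous.measurable.comp_aemeasurable
          (h.aemeasurable_eigenvector k)
      exact (Complex.measurable_ofReal.comp_aemeasurable h1).mul h2
    obtain ⟨F, hF⟩ := exists_fiber_eq_sum (fun j => chirpFourier n θ (f j)) hc (C := 1)
      (Eventually.of_forall fun x => by
        have h1 : ‖principalVector (fun j => torusFiber θ (f j) x) (y k x) (μ k x)‖ ≤ 1 := by
          rcases (orthonormalOrZero_principalVector (h.orthonormal x) (h.mulVec_eq x)).2 k
            with h | h <;> simp [h]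
        rw [hsum, ENNReal.coe_one, ← ofReal_norm]
        exact ENNReal.ofReal_le_one.2 h1)
    refine ⟨(chirpFourier n θ).symm F, ?_⟩
    filter_upwards [hF] with x hx
    rw [torusFiber, LinearIsometryEquiv.apply_symm_apply, hx, hsum]
  · simp only [dif_neg hi]
    exact ⟨0, ae_torusFiber_zero θ⟩

/-- The generators with principal fibers give a Parseval frame, and attain the lower bound of
`tail_le_approxError`. -/
theorem IsGramEigensystem.exists_optimal (h : IsGramEigensystem θ f μ y) (ℓ : ℕ) :
    ∃ φ : Fin ℓ → L2Space n, IsParsevalFrameFor (thetaShifts θ φ) (thetaShiftSpace θ φ) ∧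
      approxError θ f φ =
        ∑ k ∈ Finset.univ.filter (fun k : Fin m => ℓ ≤ (k : ℕ)), ∫ x, μ k x := by
  obtain ⟨φ, hφ⟩ := h.exists_generators ℓ
  rw [← ae_all_iff] at hφ
  have hortho : ∀ᵐ x, OrthonormalOrZero fun i => torusFiber θ (φ i) x := by
    filter_upwards [hφ] with x hx
    have hq := orthonormalOrZero_principalVector (h.orthonormal x) (h.mulVec_eq x)
    refine ⟨fun i j hij => ?_, fun i => ?_⟩
    · simp only [hx]
      split_ifs with hi hj
      · exact hq.1 _ _ fun e => hij (Fin.ext (Fin.mk.inj_iff.1 e))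
      all_goals simp
    · simp only [hx]
      split_ifs with hi
      · exact hq.2 _
      · exact Or.inl rfl
  refine ⟨φ, isParsevalFrameFor_thetaShifts hortho, ?_⟩
  have hcapture : ∀ᵐ x, ∑ j, ∑ i, ‖inner ℂ (torusFiber θ (φ i) x) (torusFiber θ (f j) x)‖ ^ 2 =
      ∑ k : Fin m, if ℓ ≤ (k : ℕ) then 0 else μ k x := by
    filter_upwards [hφ] with x hx
    rw [Finset.sum_comm]
    have h1 : ∀ i, ∑ j, ‖inner ℂ (torusFiber θ (φ i) x) (torusFiber θ (f j) x)‖ ^ 2 =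
        if hi : (i : ℕ) < m then μ ⟨i, hi⟩ x else 0 := fun i => by
      rw [hx]
      split_ifs with hi
      · exact sum_norm_sq_inner_principalVector (h.orthonormal x) (h.mulVec_eq x) ⟨i, hi⟩
      · simp
    simp_rw [h1]
    -- Both sides are the sum over `j < min ℓ m`.
    have h2 := Fin.sum_univ_eq_sum_range (fun j => if hi : j < m then μ ⟨j, hi⟩ x else 0) ℓ
    have h3 := Fin.sum_univ_eq_sum_range
      (fun j => if hi : j < m then (if ℓ ≤ j then 0 else μ ⟨j, hi⟩ x) else 0) m
    simp only [Fin.is_lt, dite_true, Fin.eta] at h3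
    rw [h2, h3]
    rcases le_total ℓ m with hℓ | hℓ
    · refine Finset.sum_subset_zero_on_sdiff (Finset.range_mono hℓ) (fun j hj => ?_) fun j hj => ?_
      · rw [Finset.mem_sdiff, Finset.mem_range, Finset.mem_range] at hj
        rw [dif_pos hj.1, if_pos (by omega)]
      · rw [Finset.mem_range] at hj
        simp only [if_neg (show ¬ ℓ ≤ j by omega)]
    · refine (Finset.sum_subset_zero_on_sdiff (Finset.range_mono hℓ) (fun j hj => ?_)
        fun j hj => ?_).symm
      · rw [Finset.mem_sdiff, Finset.mem_range, Finset.mem_range] at hj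
        rw [dif_neg hj.2]
      · rw [Finset.mem_range] at hj
        simp only [if_neg (show ¬ ℓ ≤ j by omega)]
  have hint := fun j => integrable_sum_norm_sq_inner_torusFiber hortho (f j)
  have hint' : ∀ k : Fin m, Integrable fun x => if ℓ ≤ (k : ℕ) then 0 else μ k x := fun k => by
    split_ifs
    · exact integrable_zero _ _ _
    · exact h.integrable k
  simp only [approxError]
  simp_rw [norm_sq_sub_starProjection_thetaShiftSpace hortho]
  rw [Finset.sum_sub_distrib, ← integral_finsetSum _ fun j _ => hint j,
    integral_congr_ae hcapture, integral_finsetSum _ fun k _ => hint' k]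
  simp_rw [← integral_norm_sq_torusFiber θ]
  rw [← integral_finsetSum _ fun i _ => integrable_norm_sq_torusFiber θ (f i)]
  simp_rw [← h.sum_eq]
  rw [integral_finsetSum _ fun k _ => h.integrable k, ← Finset.sum_sub_distrib, Finset.sum_filter]
  refine Finset.sum_congr rfl fun k _ => ?_
  split_ifs <;> simp

end GramDiagonalization

section ThetaCube

variable {n m : ℕ} {θ : ℝ}

theorem ae_thetaCube_of_ae_torus (hθ : Real.sin θ ≠ 0) {P : UnitAddTorus (Fin n) → Prop}
    (h : ∀ᵐ x, P x) :
    ∀ᵐ ω ∂(volume.restrict (thetaCube n θ)), P (toTorus ((Real.sin θ)⁻¹ • ω)) :=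
  (measurePreserving_toTorus_thetaCube hθ).quasiMeasurePreserving.ae (Measure.ae_smul_measure h _)

/-- Over almost every `ω` the fiber `thetaFiber` is, up to the normalizing constant and a shift
of the index, the fiber over the corresponding point of the torus. -/
theorem ae_thetaFiber_eq (hθ : Real.sin θ ≠ 0) (f : Fin m → L2Space n) :
    ∀ᵐ ω ∂(volume.restrict (thetaCube n θ)), ∃ k₀ : Fin n → ℤ, ∀ i k,
      thetaFiber θ (f i) ω k = (((√(|Real.sin θ| ^ n))⁻¹ : ℝ) : ℂ) *
        torusFiber θ (f i) (toTorus ((Real.sin θ)⁻¹ • ω)) (k₀ + k) := by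
  have h : ∀ᵐ x, ∀ i, ∀ k, torusFiber θ (f i) x k = chirpFourier n θ (f i) (torusUnfold (x, k)) :=
    ae_all_iff.2 fun i => ae_fiber_apply _
  filter_upwards [ae_thetaCube_of_ae_torus hθ h] with ω hω
  obtain ⟨k₀, hk₀⟩ := exists_torusUnfold_eq ((Real.sin θ)⁻¹ • ω)
  refine ⟨k₀, fun i k => ?_⟩
  rw [hω, ← torusUnfold_add, hk₀]
  rfl

/-- The transpose enters because `torusGram` is built from inner products, which are conjugate
linear in the first argument. -/
theorem ae_thetaGramian_eq (hθ : Real.sin θ ≠ 0) (f : Fin m → L2Space n) :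
    ∀ᵐ ω ∂(volume.restrict (thetaCube n θ)),
      (∀ i j, Summable fun k : Fin n → ℤ =>
        thetaFiber θ (f i) ω k * star (thetaFiber θ (f j) ω k)) ∧
      thetaGramian θ f ω = (((|Real.sin θ| ^ n)⁻¹ : ℝ) : ℂ) •
        (torusGram θ f (toTorus ((Real.sin θ)⁻¹ • ω))).transpose := by
  filter_upwards [ae_thetaFiber_eq hθ f] with ω hω
  obtain ⟨k₀, h⟩ := hω
  set x := toTorus ((Real.sin θ)⁻¹ • ω)
  have hc : (((√(|Real.sin θ| ^ n))⁻¹ : ℝ) : ℂ) * star (((√(|Real.sin θ| ^ n))⁻¹ : ℝ) : ℂ) =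
      (((|Real.sin θ| ^ n)⁻¹ : ℝ) : ℂ) := by
    rw [← starRingEnd_apply, Complex.conj_ofReal, ← Complex.ofReal_mul, ← mul_inv,
      Real.mul_self_sqrt (by positivity)]
  have hs : ∀ i j, HasSum (fun k : Fin n → ℤ =>
      thetaFiber θ (f i) ω k * star (thetaFiber θ (f j) ω k))
      ((((|Real.sin θ| ^ n)⁻¹ : ℝ) : ℂ) * inner ℂ (torusFiber θ (f j) x) (torusFiber θ (f i) x)) :=
    fun i j => by
    have h1 := ((Equiv.addLeft k₀).hasSum_iff.2
      (lp.hasSum_inner (𝕜 := ℂ) (torusFiber θ (f j) x) (torusFiber θ (f i) x))).mul_left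
      (((|Real.sin θ| ^ n)⁻¹ : ℝ) : ℂ)
    refine h1.congr_fun fun k => ?_
    rw [h, h, star_mul, ← hc]
    simp only [Function.comp_apply, Equiv.coe_addLeft, RCLike.inner_apply, starRingEnd_apply]
    ring
  refine ⟨fun i j => (hs i j).summable, ?_⟩
  ext i j
  exact (hs i j).tsum_eq

variable {f : Fin m → L2Space n} {μ : Fin m → UnitAddTorus (Fin n) → ℝ}
  {y : Fin m → UnitAddTorus (Fin n) → EuclideanSpace ℂ (Fin m)}

theorem IsGramEigensystem.ae_thetaGramianEigenvalue_eq (h : IsGramEigensystem θ f μ y)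
    (hθ : Real.sin θ ≠ 0) :
    ∀ᵐ ω ∂(volume.restrict (thetaCube n θ)), ∀ k, thetaGramianEigenvalue θ f k ω =
      (|Real.sin θ| ^ n)⁻¹ * μ k (toTorus ((Real.sin θ)⁻¹ • ω)) := by
  filter_upwards [ae_thetaGramian_eq hθ f] with ω hω' k
  have hω := hω'.2
  set x := toTorus ((Real.sin θ)⁻¹ • ω)
  have h0 : 0 ≤ (|Real.sin θ| ^ n)⁻¹ := by positivity
  refine (isHermitian_thetaGramian θ f ω).eigenvalues₀_eq_of_charpoly
    (μ := fun k => (|Real.sin θ| ^ n)⁻¹ * μ k x)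
    (fun i j hij => mul_le_mul_of_nonneg_left (h.antitone x hij) h0) ?_ k
  rw [hω, ← Matrix.transpose_smul, Matrix.charpoly_transpose]
  refine Matrix.charpoly_eq_prod_of_eigenbasis (h.orthonormal x) fun i => ?_
  rw [Matrix.smul_mulVec, h.mulVec_eq, smul_smul, ← Complex.ofReal_mul]

theorem IsGramEigensystem.integral_thetaGramianEigenvalue (h : IsGramEigensystem θ f μ y)
    (hθ : Real.sin θ ≠ 0) (k : Fin m) :
    IntegrableOn (thetaGramianEigenvalue θ f k) (thetaCube n θ) volume ∧
      ∫ ω in thetaCube n θ, thetaGramianEigenvalue θ f k ω = ∫ x, μ k x := by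
  have hmp := measurePreserving_toTorus_thetaCube (n := n) hθ
  have hpos : 0 < |Real.sin θ| ^ n := pow_pos (abs_pos.2 hθ) n
  have hint : Integrable (μ k) (ENNReal.ofReal (|Real.sin θ| ^ n) • volume) :=
    (h.integrable k).smul_measure ENNReal.ofReal_ne_top
  have hcongr : thetaGramianEigenvalue θ f k =ᵐ[volume.restrict (thetaCube n θ)]
      fun ω => (|Real.sin θ| ^ n)⁻¹ * μ k (toTorus ((Real.sin θ)⁻¹ • ω)) := by
    filter_upwards [h.ae_thetaGramianEigenvalue_eq hθ] with ω hω
    exact hω k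
  refine ⟨((hmp.integrable_comp_of_integrable hint).const_mul _).congr hcongr.symm, ?_⟩
  have h1 : ∫ ω in thetaCube n θ, μ k (toTorus ((Real.sin θ)⁻¹ • ω)) =
      ∫ x, μ k x ∂(ENNReal.ofReal (|Real.sin θ| ^ n) • volume) := by
    rw [← hmp.map_eq]
    refine (integral_map hmp.measurable.aemeasurable ?_).symm
    rw [hmp.map_eq]
    exact hint.aestronglyMeasurable
  rw [integral_congr_ae hcongr, integral_const_mul, h1, integral_smul_measure,
    ENNReal.toReal_ofReal hpos.le, smul_eq_mul, inv_mul_cancel_left₀ hpos.ne']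

end ThetaCube

end

theorem theorem4p5 (n m ℓ : ℕ) (θ : ℝ) (hθ : Real.sin θ ≠ 0) (f : Fin m → L2Space n) :
    -- the entries of the Gramian converge, and its eigenvalues are well-behaved
    (∀ᵐ ω ∂(volume.restrict (thetaCube n θ)),
      (∀ i j, Summable fun k : Fin n → ℤ =>
        thetaFiber θ (f i) ω k * star (thetaFiber θ (f j) ω k)) ∧
      (Antitone fun i => thetaGramianEigenvalue θ f i ω) ∧
      ∀ i, 0 ≤ thetaGramianEigenvalue θ f i ω) ∧
    (∀ i, IntegrableOn (thetaGramianEigenvalue θ f i) (thetaCube n θ) volume) ∧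
    ∃ φ : Fin ℓ → L2Space n,
      (∀ r ≤ ℓ, ∀ ψ : Fin r → L2Space n, approxError θ f φ ≤ approxError θ f ψ) ∧
      IsParsevalFrameFor (thetaShifts θ φ) (thetaShiftSpace θ φ) ∧
      approxError θ f φ =
        ∑ i ∈ Finset.univ.filter (fun i : Fin m => ℓ ≤ (i : ℕ)),
          ∫ ω in thetaCube n θ, thetaGramianEigenvalue θ f i ω := by
  obtain ⟨μ, y, h⟩ := exists_isGramEigensystem θ f
  refine ⟨?_, fun i => (h.integral_thetaGramianEigenvalue hθ i).1, ?_⟩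
  · filter_upwards [ae_thetaGramian_eq hθ f, h.ae_thetaGramianEigenvalue_eq hθ] with ω h1 h2
    refine ⟨h1.1, fun i j hij => ?_, fun i => ?_⟩
    · exact (isHermitian_thetaGramian θ f ω).eigenvalues₀_antitone hij
    · rw [h2]
      exact mul_nonneg (by positivity) (h.nonneg i _)
  · obtain ⟨φ, hframe, herr⟩ := h.exists_optimal ℓ
    refine ⟨φ, fun r hr ψ => herr ▸ h.tail_le_approxError hr ψ, hframe, ?_⟩
    rw [herr]
    exact Finset.sum_congr rfl fun i _ => (h.integral_thetaGramianEigenvalue hθ i).2.symm
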